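/- Let $SL(2,\mathbb C)$ and $K=SU(2)$ carry their topologies as subspaces of $M_2(\mathbb C)$ and their Borel $\sigma$-algebras, and for $r\in\mathbb R$ and $x\ge 1$ put $$A_r=\begin{pmatrix}e^{r/2}&0\\0&e^{-r/2}\end{pmatrix},\qquad A_x=\begin{pmatrix}x&0\\0&x^{-1}\end{pmatrix},\qquad \mathcal A^+=\{A_r: r\ge 0\}.$$ **(1)** $SL(2,\mathbb C)=K\,\mathcal A^+K$: every $g\in SL(2,\mathbb C)$ is of the form $kA_rk'$ with $k,k'\in K$, $r\ge 0$. The substitution $x=e^{r/2}$ is a bijection $[0,\infty)\to[1,\infty)$, and it turns $A_r$ into $A_x$. **(2)** Let $\mu_K,\mu_K'$ be any two Haar measures on $K$, written as $\omega_K,\omega_K'$, and consider the measures $$\omega=\sinh^2(r)\;\omega_K\wedge dr\wedge\omega_K'\ \text{ on } K\times[0,\infty)\times K,\qquad \tilde\omega=2\Big(\frac{x^2-x^{-2}}2\Big)^2x^{-1}\;\omega_K\wedge dx\wedge\omega_K'\ \text{ on } K\times[1,\infty)\times K,$$ i.e. the measures having these densities with respect to the product of $\mu_K$, Lebesgue measure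 and $\mu_K'$. Then the image of $\omega$ under $(k,r,k')\mapsto kA_rk'$ is a (left and right invariant) Haar measure on $SL(2,\mathbb C)$. It coincides with the image of $\tilde\omega$ under $(k,x,k')\mapsto kA_xk'$, and $\tilde\omega$ is the image of $\omega$ under $(k,r,k')\mapsto(k,e^{r/2},k')$. Consequently, for every Haar measure $\mu$ on $SL(2,\mathbb C)$ there is a constant $c>0$ (a normalisation) such that $\mu$ is $c$ times this image measure, and for every Borel function $f:SL(2,\mathbb C)\to\mathbb R$ (in particular every smooth one) $$\int f\,d\mu=c\int_{K\times[0,\infty)\times K}\sinh^2(r)\,f(kA_rk')\;d\mu_K(k)\,dr\,d\mu_K'(k') =c\int_{K\times[1,\infty)\times K}2\Big(\frac{x^2-x^{-2}}2\Big)^2x^{-1}f(kA_xk')\;d\mu_K(k)\,dx\,d\mu_K'(k'),$$ where the integrands of all three integrals are integrable as soon as one of them is. **(3)** Let $\mathfrak k=\mathfrak{su}(2)$ (traceless antihermitian matrices), let $\mathfrak a$ be the space of real diagonal traceless matrices, and let $\sigma_x,\sigma_y,\sigma_z$ be the Pauli matrices. For every $r\in\mathbb R$ the map $$\varphi_r:\mathfrak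 k\oplus\mathfrak a\oplus\mathfrak k\to SL(2,\mathbb C)\subset M_2(\mathbb C),\qquad (X,Y,X')\mapsto A_r^{-1}\exp(X)\,A_r\exp(Y)\exp(X'),$$ which is the left translate by $A_r^{-1}$ of the parametrisation $(k,a,k')\mapsto kak'$ near $(1,A_r,1)$ in exponential coordinates, is differentiable at $0$. Its differential takes values in $\mathfrak{sl}(2,\mathbb C)$, the space of traceless matrices. In the basis $i\sigma_y,i\sigma_y',i\sigma_x,i\sigma_x',i\sigma_z,i\sigma_z',\sigma_z$ of $\mathfrak k\oplus\mathfrak a\oplus\mathfrak k$ (primes mark the second copy of $\mathfrak k$) and the real basis $i\sigma_y,\sigma_x,i\sigma_x,\sigma_y,i\sigma_z,\sigma_z$ of $\mathfrak{sl}(2,\mathbb C)$ its matrix is, with $c=\cosh r$ and $s=\sinh r$, $$\begin{pmatrix} c&1&0&0&0&0&0\\-s&0&0&0&0&0&0\\0&0&c&1&0&0&0\\0&0&s&0&0&0&0\\0&0&0&0&1&1&0\\0&0&0&0&0&0&1\end{pmatrix}.$$ The $6\times 6$ minor of this matrix obtained by removing the 5th or the 6th column has absolute value $\sinh^2(r)$,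 and each of the other five maximal minors is $0$. -/

import Mathlib

open MeasureTheory Matrix
open scoped ENNReal

namespace CartanSL2

noncomputable section

/-! ### The groups, with their Borel σ-algebras, and the Cartan coordinates -/

/-- The complex `2 × 2` matrices. -/
abbrev M2 : Type := Matrix (Fin 2) (Fin 2) ℂ

/-- The group `SL(2, ℂ)` with the topology of a subspace of `M₂(ℂ)`. -/
abbrev SL2C : Type := Matrix.SpecialLinearGroup (Fin 2) ℂ

/-- The group `SU(2)` with the topology of a subspace of `M₂(ℂ)`. -/
abbrev SU2 : Type := Matrix.specialUnitaryGroup (Fin 2) ℂ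

instance instMeasurableSpaceSL2C : MeasurableSpace SL2C := borel SL2C

instance instBorelSpaceSL2C : BorelSpace SL2C := ⟨rfl⟩

instance instMeasurableSpaceSU2 : MeasurableSpace SU2 := borel SU2

instance instBorelSpaceSU2 : BorelSpace SU2 := ⟨rfl⟩

/-- The inclusion of `SU(2)` into `SL(2, ℂ)`. -/
def toSL (k : SU2) : SL2C := ⟨(k : M2), k.2.2⟩

/-- `A_r = diag(e^{r/2}, e^{-r/2})`. -/
def cartanA (r : ℝ) : SL2C :=
  ⟨!![((Real.exp (r / 2) : ℝ) : ℂ), 0; 0, ((Real.exp (-(r / 2)) : ℝ) : ℂ)], by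
    rw [Matrix.det_fin_two_of, mul_zero, sub_zero, ← Complex.ofReal_mul, ← Real.exp_add,
      add_neg_cancel, Real.exp_zero, Complex.ofReal_one]⟩

/-- `A_x = diag(x, x⁻¹)` for `x ≥ 1`. -/
def cartanAx (x : Set.Ici (1 : ℝ)) : SL2C :=
  ⟨!![((x : ℝ) : ℂ), 0; 0, (((x : ℝ)⁻¹ : ℝ) : ℂ)], by
    have hx : (x : ℝ) ≠ 0 := (lt_of_lt_of_le one_pos x.2).ne'
    rw [Matrix.det_fin_two_of, mul_zero, sub_zero, ← Complex.ofReal_mul, mul_inv_cancel₀ hx,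
      Complex.ofReal_one]⟩

/-- The parametrisation `(k, r, k') ↦ k A_r k'`, for `r ≥ 0`. -/
def kak (p : SU2 × Set.Ici (0 : ℝ) × SU2) : SL2C :=
  toSL p.1 * cartanA p.2.1 * toSL p.2.2

/-- The parametrisation `(k, x, k') ↦ k A_x k'`, for `x ≥ 1`. -/
def kakx (p : SU2 × Set.Ici (1 : ℝ) × SU2) : SL2C :=
  toSL p.1 * cartanAx p.2.1 * toSL p.2.2

/-- The substitution `x = e^{r/2}`. -/
def expHalf (r : Set.Ici (0 : ℝ)) : Set.Ici (1 : ℝ) :=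
  ⟨Real.exp ((r : ℝ) / 2), Real.one_le_exp (div_nonneg r.2 zero_le_two)⟩

/-- Lebesgue measure on the ray `[a, ∞)`. -/
def lebesgueIci (a : ℝ) : Measure (Set.Ici a) := (volume : Measure ℝ).comap Subtype.val

/-- The measure `sinh²(r) · ω_K ∧ dr ∧ ω'_K` on `SU(2) × [0, ∞) × SU(2)`, where `ω_K` and `ω'_K`
stand for the measures `μ` and `μ'`. -/
def cartanMeasure (μ μ' : Measure SU2) : Measure (SU2 × Set.Ici (0 : ℝ) × SU2) :=
  (μ.prod ((lebesgueIci 0).prod μ')).withDensity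
    fun p => ENNReal.ofReal (Real.sinh (p.2.1 : ℝ) ^ 2)

/-- The measure `2 ((x² - x⁻²) / 2)² x⁻¹ · ω_K ∧ dx ∧ ω'_K` on `SU(2) × [1, ∞) × SU(2)`. -/
def cartanMeasureX (μ μ' : Measure SU2) : Measure (SU2 × Set.Ici (1 : ℝ) × SU2) :=
  (μ.prod ((lebesgueIci 1).prod μ')).withDensity
    fun p => ENNReal.ofReal
      (2 * (((p.2.1 : ℝ) ^ 2 - ((p.2.1 : ℝ) ^ 2)⁻¹) / 2) ^ 2 * (p.2.1 : ℝ)⁻¹)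

/-! ### The Lie algebras and the differential of the parametrisation -/

/-- `𝔰𝔩(2, ℂ)`, the tangent space of `SL(2, ℂ)` at `1`: traceless matrices, as a real space. -/
def sl2 : Submodule ℝ M2 where
  carrier := {X | X.trace = 0}
  add_mem' {X Y} hX hY := by
    simp only [Set.mem_ofPred_eq] at *
    rw [Matrix.trace_add, hX, hY, add_zero]
  zero_mem' := Matrix.trace_zero _ _
  smul_mem' c X hX := by
    simp only [Set.mem_ofPred_eq] at *
    rw [Matrix.trace_smul, hX, smul_zero]

/-- `𝔨 = 𝔰𝔲(2)`: antihermitian traceless matrices. -/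
def su2 : Submodule ℝ M2 where
  carrier := {X | Xᴴ = -X ∧ X.trace = 0}
  add_mem' {X Y} hX hY := by
    simp only [Set.mem_ofPred_eq] at *
    refine ⟨?_, ?_⟩
    · rw [Matrix.conjTranspose_add, hX.1, hY.1, neg_add]
    · rw [Matrix.trace_add, hX.2, hY.2, add_zero]
  zero_mem' := ⟨by simp, Matrix.trace_zero _ _⟩
  smul_mem' c X hX := by
    simp only [Set.mem_ofPred_eq] at *
    refine ⟨?_, ?_⟩
    · rw [Matrix.conjTranspose_smul, hX.1, star_trivial, smul_neg]
    · rw [Matrix.trace_smul, hX.2, smul_zero]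

/-- `𝔞`: real diagonal traceless matrices. -/
def diagA : Submodule ℝ M2 where
  carrier := {X | (∃ v : Fin 2 → ℝ, X = Matrix.diagonal fun i => (v i : ℂ)) ∧ X.trace = 0}
  add_mem' {X Y} hX hY := by
    simp only [Set.mem_ofPred_eq] at *
    obtain ⟨⟨v, rfl⟩, hX⟩ := hX
    obtain ⟨⟨w, rfl⟩, hY⟩ := hY
    refine ⟨⟨v + w, ?_⟩, ?_⟩
    · rw [Matrix.diagonal_add]; simp
    · rw [Matrix.trace_add, hX, hY, add_zero]
  zero_mem' := ⟨⟨0, by simp⟩, Matrix.trace_zero _ _⟩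
  smul_mem' c X hX := by
    simp only [Set.mem_ofPred_eq] at *
    obtain ⟨⟨v, rfl⟩, hX⟩ := hX
    refine ⟨⟨c • v, ?_⟩, ?_⟩
    · ext i j; fin_cases i <;> fin_cases j <;> simp
    · rw [Matrix.trace_smul, hX, smul_zero]

/-- The Pauli matrices `σ_x`, `σ_y`, `σ_z`. -/
def σx : M2 := !![0, 1; 1, 0]

def σy : M2 := !![0, -Complex.I; Complex.I, 0]

def σz : M2 := !![1, 0; 0, -1]

/-- `φ_r : 𝔨 ⊕ 𝔞 ⊕ 𝔨 → SL(2, ℂ) ⊆ M₂(ℂ)`,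
`(K, A, K') ↦ A_r⁻¹ · exp K · A_r · exp A · exp K'`: the left translate by `A_r⁻¹` of the
parametrisation `(k, a, k') ↦ k a k'` around `(1, A_r, 1)`, in exponential coordinates. -/
def phi (r : ℝ) (p : su2 × diagA × su2) : M2 :=
  ((cartanA r)⁻¹ : SL2C).1 * NormedSpace.exp (p.1 : M2) * (cartanA r).1 *
    NormedSpace.exp (p.2.1 : M2) * NormedSpace.exp (p.2.2 : M2)

/-- `iσ_x` as an element of `𝔰𝔲(2)`. -/
def kx : su2 := ⟨Complex.I • σx, by
  refine ⟨?_, ?_⟩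
  · ext i j; fin_cases i <;> fin_cases j <;> simp [σx]
  · simp [σx, Matrix.trace_fin_two]⟩

/-- `iσ_y` as an element of `𝔰𝔲(2)`. -/
def ky : su2 := ⟨Complex.I • σy, by
  refine ⟨?_, ?_⟩
  · ext i j; fin_cases i <;> fin_cases j <;> simp [σy]
  · simp [σy, Matrix.trace_fin_two]⟩

/-- `iσ_z` as an element of `𝔰𝔲(2)`. -/
def kz : su2 := ⟨Complex.I • σz, by
  refine ⟨?_, ?_⟩
  · ext i j; fin_cases i <;> fin_cases j <;> simp [σz]
  · simp [σz, Matrix.trace_fin_two]⟩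

/-- `σ_z` as an element of `𝔞`. -/
def az : diagA := ⟨σz, by
  refine ⟨⟨![1, -1], ?_⟩, ?_⟩
  · ext i j; fin_cases i <;> fin_cases j <;> simp [σz]
  · simp [σz, Matrix.trace_fin_two]⟩

/-- `iσ_y, iσ_y', iσ_x, iσ_x', iσ_z, iσ_z', σ_z` in `𝔨 ⊕ 𝔞 ⊕ 𝔨`; a prime marks the second copy
of `𝔨`. -/
def domVec : Fin 7 → su2 × diagA × su2 :=
  ![(ky, 0, 0), (0, 0, ky), (kx, 0, 0), (0, 0, kx), (kz, 0, 0), (0, 0, kz), (0, az, 0)]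

lemma trace_pauli : ∀ i : Fin 6,
    (![Complex.I • σy, σx, Complex.I • σx, σy, Complex.I • σz, σz] i) ∈ sl2 := by
  intro i
  change Matrix.trace _ = 0
  fin_cases i <;> simp [σx, σy, σz, Matrix.trace_fin_two]

/-- `iσ_y, σ_x, iσ_x, σ_y, iσ_z, σ_z` in `𝔰𝔩(2, ℂ)`. -/
def codVec (i : Fin 6) : sl2 :=
  ⟨![Complex.I • σy, σx, Complex.I • σx, σy, Complex.I • σz, σz] i, trace_pauli i⟩

lemma su2_eq (X : su2) : X = (X.1 0 1).im • kx + (X.1 0 1).re • ky + (X.1 0 0).im • kz := by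
  obtain ⟨X, h, ht⟩ := X
  have h00 := congrFun (congrFun h 0) 0
  have h10 := congrFun (congrFun h 1) 0
  rw [Matrix.trace_fin_two] at ht
  simp only [Matrix.conjTranspose_apply, Matrix.neg_apply, Complex.ext_iff, Complex.star_def,
    Complex.conj_re, Complex.conj_im, Complex.neg_re, Complex.neg_im, Complex.add_re,
    Complex.add_im, Complex.zero_re, Complex.zero_im] at h00 h10 ht
  apply Subtype.ext
  ext i j
  fin_cases i <;> fin_cases j <;>
    simp [kx, ky, kz, σx, σy, σz, Complex.ext_iff] <;> (try constructor) <;> linarith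

lemma diagA_eq (X : diagA) : X = (X.1 0 0).re • az := by
  obtain ⟨X, ⟨v, rfl⟩, ht⟩ := X
  rw [Matrix.trace_fin_two] at ht
  simp only [Matrix.diagonal_apply_eq, Complex.ext_iff, Complex.add_re, Complex.ofReal_re,
    Complex.zero_re] at ht
  apply Subtype.ext
  ext i j
  fin_cases i <;> fin_cases j <;> simp [az, σz, Complex.ext_iff]
  linarith [ht.1]

lemma sl2_eq (X : sl2) :
    X = (((X.1 0 1).re - (X.1 1 0).re) / 2) • codVec 0
      + (((X.1 0 1).re + (X.1 1 0).re) / 2) • codVec 1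
      + (((X.1 0 1).im + (X.1 1 0).im) / 2) • codVec 2
      + (((X.1 1 0).im - (X.1 0 1).im) / 2) • codVec 3
      + (X.1 0 0).im • codVec 4 + (X.1 0 0).re • codVec 5 := by
  obtain ⟨X, ht⟩ := X
  change Matrix.trace X = 0 at ht
  rw [Matrix.trace_fin_two] at ht
  simp only [Complex.ext_iff, Complex.add_re, Complex.add_im, Complex.zero_re,
    Complex.zero_im] at ht
  apply Subtype.ext
  ext i j
  fin_cases i <;> fin_cases j <;>
    simp [codVec, σx, σy, σz, Complex.ext_iff] <;> (try constructor) <;> linarith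

lemma domVec_linearIndependent : LinearIndependent ℝ domVec := by
  rw [Fintype.linearIndependent_iff]
  intro g hg
  have h1 := congrArg (fun p => (p.1 : M2)) hg
  have h2 := congrArg (fun p => (p.2.1 : M2)) hg
  have h3 := congrArg (fun p => (p.2.2 : M2)) hg
  simp only [Fin.sum_univ_succ] at h1 h2 h3
  have a1 := congrFun (congrFun h1 0) 0
  have a2 := congrFun (congrFun h1 0) 1
  have a3 := congrFun (congrFun h2 0) 0
  have a4 := congrFun (congrFun h3 0) 0
  have a5 := congrFun (congrFun h3 0) 1
  simp [domVec, kx, ky, kz, az, σx, σy, σz, Complex.ext_iff] at a1 a2 a3 a4 a5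
  intro i
  fin_cases i <;> simp <;> tauto

lemma domVec_span : ⊤ ≤ Submodule.span ℝ (Set.range domVec) := by
  rintro ⟨X, A, Y⟩ -
  have key : (X, A, Y) = (X.1 0 1).re • domVec 0 + (Y.1 0 1).re • domVec 1
      + (X.1 0 1).im • domVec 2 + (Y.1 0 1).im • domVec 3
      + (X.1 0 0).im • domVec 4 + (Y.1 0 0).im • domVec 5 + (A.1 0 0).re • domVec 6 := by
    refine Prod.ext ?_ (Prod.ext ?_ ?_)
    · conv_lhs => rw [su2_eq X]
      simp [domVec]; abel
    · conv_lhs => rw [diagA_eq A]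
      simp [domVec]
    · conv_lhs => rw [su2_eq Y]
      simp [domVec]; abel
  have hm : ∀ i, domVec i ∈ Submodule.span ℝ (Set.range domVec) :=
    fun i => Submodule.subset_span ⟨i, rfl⟩
  rw [key]
  exact add_mem (add_mem (add_mem (add_mem (add_mem (add_mem (Submodule.smul_mem _ _ (hm 0))
    (Submodule.smul_mem _ _ (hm 1))) (Submodule.smul_mem _ _ (hm 2)))
    (Submodule.smul_mem _ _ (hm 3))) (Submodule.smul_mem _ _ (hm 4)))
    (Submodule.smul_mem _ _ (hm 5))) (Submodule.smul_mem _ _ (hm 6))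

lemma codVec_linearIndependent : LinearIndependent ℝ codVec := by
  rw [Fintype.linearIndependent_iff]
  intro g hg
  have h1 := congrArg (fun p : sl2 => (p : M2)) hg
  simp only [Fin.sum_univ_succ] at h1
  have a1 := congrFun (congrFun h1 0) 0
  have a2 := congrFun (congrFun h1 0) 1
  have a3 := congrFun (congrFun h1 1) 0
  simp [codVec, σx, σy, σz, Complex.ext_iff] at a1 a2 a3
  intro i
  fin_cases i <;> simp <;> linarith [a1.1, a1.2, a2.1, a2.2, a3.1, a3.2]

lemma codVec_span : ⊤ ≤ Submodule.span ℝ (Set.range codVec) := by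
  rintro X -
  have hm : ∀ i, codVec i ∈ Submodule.span ℝ (Set.range codVec) :=
    fun i => Submodule.subset_span ⟨i, rfl⟩
  rw [sl2_eq X]
  exact add_mem (add_mem (add_mem (add_mem (add_mem (Submodule.smul_mem _ _ (hm 0))
    (Submodule.smul_mem _ _ (hm 1))) (Submodule.smul_mem _ _ (hm 2)))
    (Submodule.smul_mem _ _ (hm 3))) (Submodule.smul_mem _ _ (hm 4)))
    (Submodule.smul_mem _ _ (hm 5))

/-- The basis `iσ_y, iσ_y', iσ_x, iσ_x', iσ_z, iσ_z', σ_z` of `𝔨 ⊕ 𝔞 ⊕ 𝔨`. -/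
def domBasis : Module.Basis (Fin 7) ℝ (su2 × diagA × su2) :=
  Module.Basis.mk domVec_linearIndependent domVec_span

/-- The basis `iσ_y, σ_x, iσ_x, σ_y, iσ_z, σ_z` of `𝔰𝔩(2, ℂ)`. -/
def codBasis : Module.Basis (Fin 6) ℝ sl2 :=
  Module.Basis.mk codVec_linearIndependent codVec_span

/-- The maximal minor of a `6 × 7` matrix obtained by removing the column `j`. -/
def maxMinor (J : Matrix (Fin 6) (Fin 7) ℝ) (j : Fin 7) : ℝ :=
  (J.submatrix id j.succAbove).det

end

end CartanSL2

open CartanSL2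

/-!
`SL(2, ℂ)` acts transitively on `ℂ² \ {0}`, with unipotent stabilizers isomorphic to `ℂ`, and it
preserves Lebesgue measure there. Hence `v ∈ ℂ²` and `z ∈ ℂ`, both distributed by Lebesgue measure,
are coordinates in which Haar measure is Lebesgue measure on `ℂ² × ℂ`. In these coordinates the
squared Frobenius norm of `g` is explicit, and its law under Haar measure is the image of
`sinh² r dr` under `r ↦ 2 cosh r`, up to a constant. Since the norm of `k A_r k'` is `2 cosh r`,
averaging a function over `K × K` leaves a function of the norm alone, and this gives the integral
formula. Right invariance of Haar measure holds because `SL(2, ℂ)` is perfect.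
-/

namespace CartanSL2

section SpecialGroups

instance {m n R : Type*} [Countable m] [Countable n] [TopologicalSpace R]
    [SecondCountableTopology R] : SecondCountableTopology (Matrix m n R) :=
  inferInstanceAs (SecondCountableTopology (m → n → R))

instance {m n R : Type*} [Finite m] [Finite n] [TopologicalSpace R] [LocallyCompactSpace R] :
    LocallyCompactSpace (Matrix m n R) :=
  inferInstanceAs (LocallyCompactSpace (m → n → R))

variable {n 𝕜 : Type*} [Fintype n] [DecidableEq n] [RCLike 𝕜]

lemma mem_specialUnitaryGroup_iff_conjTranspose_mul {A : Matrix n n 𝕜} :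
    A ∈ specialUnitaryGroup n 𝕜 ↔ Aᴴ * A = 1 ∧ A.det = 1 := by
  rw [mem_specialUnitaryGroup_iff, mem_unitaryGroup_iff', star_eq_conjTranspose]

lemma isClosed_specialUnitaryGroup : IsClosed (specialUnitaryGroup n 𝕜 : Set (Matrix n n 𝕜)) := by
  have h : (specialUnitaryGroup n 𝕜 : Set (Matrix n n 𝕜)) = {A | Aᴴ * A = 1} ∩ {A | A.det = 1} :=
    Set.ext fun A => mem_specialUnitaryGroup_iff_conjTranspose_mul
  rw [h]
  exact (isClosed_eq (by fun_prop) continuous_const).inter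
    (isClosed_eq (by fun_prop) continuous_const)

instance : CompactSpace (specialUnitaryGroup n 𝕜) := by
  refine isCompact_iff_compactSpace.1 <| (isCompact_univ_pi fun _ => isCompact_univ_pi fun _ =>
    isCompact_closedBall (0 : 𝕜) 1).of_isClosed_subset isClosed_specialUnitaryGroup ?_
  intro U hU i _ j _
  exact mem_closedBall_zero_iff.2 (entry_norm_bound_of_unitary hU.1 i j)

instance : IsTopologicalGroup (specialUnitaryGroup n 𝕜) where
  continuous_inv := (continuous_subtype_val.matrix_conjTranspose).subtype_mk _

instance : SecondCountableTopology (SpecialLinearGroup n 𝕜) :=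
  SpecialLinearGroup.isClosedEmbedding_val.isEmbedding.secondCountableTopology

instance : LocallyCompactSpace (SpecialLinearGroup n 𝕜) :=
  SpecialLinearGroup.isClosedEmbedding_val.locallyCompactSpace

instance : SecondCountableTopology (specialUnitaryGroup n 𝕜) :=
  Topology.IsEmbedding.subtypeVal.secondCountableTopology

end SpecialGroups

section HaarGeneralities

variable {G : Type*} [Group G] [TopologicalSpace G] [IsTopologicalGroup G] [MeasurableSpace G]
  [BorelSpace G]

lemma isMulRightInvariant_of_compactSpace [CompactSpace G] (μ : Measure G) [μ.IsHaarMeasure] :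
    μ.IsMulRightInvariant where
  map_mul_right_eq_self g := by
    have h := Measure.isMulInvariant_eq_smul_of_compactSpace (μ.map (· * g)) μ
    have h_univ : μ Set.univ = Measure.haarScalarFactor (μ.map (· * g)) μ * μ Set.univ := by
      have h_mass := congrArg (fun ν : Measure G => ν Set.univ) h
      rwa [Measure.map_apply (measurable_mul_const g) MeasurableSet.univ] at h_mass
    have h_factor : Measure.haarScalarFactor (μ.map (· * g)) μ = 1 :=
      ENNReal.coe_eq_one.1 <| (ENNReal.mul_eq_right
        (Measure.measure_univ_ne_zero.2 (NeZero.ne μ)) (measure_ne_top μ _)).1 h_univ.symm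
    rw [h, h_factor, one_smul]

lemma isMulRightInvariant_of_commutator_eq_top [LocallyCompactSpace G] (μ : Measure G)
    [μ.IsHaarMeasure] [μ.InnerRegular] (hG : commutator G = ⊤) : μ.IsMulRightInvariant where
  map_mul_right_eq_self g := by
    have hg : g ∈ (Measure.modularCharacter (G := G)).toHomUnits.ker :=
      Abelianization.commutator_subset_ker _ (hG ▸ Subgroup.mem_top g)
    have h_one : Measure.modularCharacterFun g = 1 := congrArg Units.val hg
    rw [Measure.map_right_mul_eq_modularCharacterFun_smul μ g, h_one, one_smul]

end HaarGeneralities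

section BiAverage

variable {K G : Type*} [Group K] [MeasurableSpace K] [Group G]

/-- The average of `f` over the double coset `φ(K) g φ(K)`, with respect to the measures `μ` and
`μ'` on the left and right copies of `K`. -/
noncomputable def biAverage (φ : K →* G) (μ μ' : Measure K) (f : G → ℝ≥0∞) (g : G) : ℝ≥0∞ :=
  ∫⁻ k, ∫⁻ k', f (φ k * g * φ k') ∂μ' ∂μ

lemma biAverage_map_mul_mul_map [MeasurableMul K] (φ : K →* G) (μ μ' : Measure K)
    [μ.IsMulRightInvariant] [μ'.IsMulLeftInvariant] (f : G → ℝ≥0∞) (g : G) (k₁ k₂ : K) :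
    biAverage φ μ μ' f (φ k₁ * g * φ k₂) = biAverage φ μ μ' f g := by
  have h (k k' : K) : φ k * (φ k₁ * g * φ k₂) * φ k' = φ (k * k₁) * g * φ (k₂ * k') := by
    simp only [map_mul, mul_assoc]
  simp only [biAverage, h]
  rw [lintegral_mul_right_eq_self (fun k => ∫⁻ k', f (φ k * g * φ (k₂ * k')) ∂μ') k₁]
  exact lintegral_congr fun k => lintegral_mul_left_eq_self (fun k' => f (φ k * g * φ k')) k₂

variable [MeasurableSpace G] [MeasurableMul₂ G] {φ : K →* G} (hφ : Measurable φ)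
  {f : G → ℝ≥0∞} (hf : Measurable f)
include hφ hf

lemma measurable_biAverage (μ μ' : Measure K) [SFinite μ] [SFinite μ'] :
    Measurable (biAverage φ μ μ' f) := by
  have h : Measurable fun q : (G × K) × K => f (φ q.1.2 * q.1.1 * φ q.2) := by fun_prop
  exact h.lintegral_prod_right'.lintegral_prod_right'

lemma lintegral_biAverage (μ μ' : Measure K) [SFinite μ] [SFinite μ'] (ν : Measure G) [SFinite ν]
    [ν.IsMulLeftInvariant] [ν.IsMulRightInvariant] :
    ∫⁻ g, biAverage φ μ μ' f g ∂ν = μ Set.univ * μ' Set.univ * ∫⁻ g, f g ∂ν := by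
  have h : Measurable fun q : (G × K) × K => f (φ q.1.2 * q.1.1 * φ q.2) := by fun_prop
  have h_inner (k : K) :
      ∫⁻ g, ∫⁻ k', f (φ k * g * φ k') ∂μ' ∂ν = (∫⁻ g, f g ∂ν) * μ' Set.univ := by
    rw [lintegral_lintegral_swap (by fun_prop), ← lintegral_const]
    refine lintegral_congr fun k' => ?_
    rw [lintegral_mul_left_eq_self (fun g => f (g * φ k')) (φ k), lintegral_mul_right_eq_self]
  simp only [biAverage]
  rw [lintegral_lintegral_swap h.lintegral_prod_right'.aemeasurable]
  simp only [h_inner, lintegral_const]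
  ring

end BiAverage

section RealIntegrals

lemma mul_lintegral_Ioi_comp_mul {c : ℝ} (hc : 0 < c) (f : ℝ → ℝ≥0∞) :
    ENNReal.ofReal c * ∫⁻ x in Set.Ioi 0, f (c * x) = ∫⁻ x in Set.Ioi 0, f x := by
  have h_image : (fun x => c * x) '' Set.Ioi 0 = Set.Ioi 0 := by
    rw [Set.image_mul_left_Ioi hc, mul_zero]
  conv_rhs => rw [← h_image]
  rw [lintegral_image_eq_lintegral_deriv_mul_of_monotoneOn measurableSet_Ioi
    (fun x _ => ((hasDerivAt_id' x).const_mul c).hasDerivWithinAt)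
    ((monotone_mul_left_of_nonneg hc.le).monotoneOn _), mul_one,
    lintegral_const_mul' _ _ ENNReal.ofReal_ne_top]

lemma lintegral_Ioi_comp_add (c : ℝ) (f : ℝ → ℝ≥0∞) :
    ∫⁻ x in Set.Ioi 0, f (c + x) = ∫⁻ x in Set.Ioi c, f x := by
  simpa using (measurePreserving_add_left volume c).setLIntegral_comp_preimage_emb
    (measurableEmbedding_addLeft c) f (Set.Ioi c)

lemma two_mul_lintegral_Ioi_mul_comp_sq (f : ℝ → ℝ≥0∞) :
    2 * ∫⁻ x in Set.Ioi 0, ENNReal.ofReal x * f (x ^ 2) = ∫⁻ s in Set.Ioi 0, f s := by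
  have h_image : (fun x : ℝ => x ^ 2) '' Set.Ioi 0 = Set.Ioi 0 := by
    ext y
    exact ⟨fun ⟨x, hx, h⟩ => h ▸ pow_pos (Set.mem_Ioi.1 hx) 2,
      fun hy => ⟨√y, Real.sqrt_pos.2 hy, Real.sq_sqrt (le_of_lt hy)⟩⟩
  have h_mono : MonotoneOn (fun x : ℝ => x ^ 2) (Set.Ioi 0) :=
    fun x hx y _ hxy => pow_le_pow_left₀ (le_of_lt hx) hxy 2
  conv_rhs => rw [← h_image]
  rw [lintegral_image_eq_lintegral_deriv_mul_of_monotoneOn measurableSet_Ioi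
      (fun x _ => (hasDerivAt_pow 2 x).hasDerivWithinAt) h_mono,
    ← lintegral_const_mul' _ _ ENNReal.ofNat_ne_top]
  refine lintegral_congr fun x => ?_
  simp only [Nat.cast_ofNat, Nat.add_one_sub_one, pow_one, ENNReal.ofReal_mul zero_le_two,
    ENNReal.ofReal_ofNat, mul_assoc]

lemma lintegral_Ioi_two_eq_cosh (f : ℝ → ℝ≥0∞) :
    ∫⁻ t in Set.Ioi 2, f t =
      ∫⁻ r in Set.Ioi 0, ENNReal.ofReal (2 * Real.sinh r) * f (2 * Real.cosh r) := by
  have h_image : (fun r => 2 * Real.cosh r) '' Set.Ioi 0 = Set.Ioi 2 := by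
    ext t
    constructor
    · rintro ⟨r, hr, rfl⟩
      exact lt_mul_of_one_lt_right two_pos (Real.one_lt_cosh.2 (ne_of_gt hr))
    · intro ht
      have ht : 1 < t / 2 := (one_lt_div two_pos).2 ht
      exact ⟨Real.arcosh (t / 2), Real.arcosh_pos ht, by simp only [Real.cosh_arcosh ht.le]; ring⟩
  have h_mono : MonotoneOn (fun r => 2 * Real.cosh r) (Set.Ioi 0) := fun x hx y hy hxy =>
    mul_le_mul_of_nonneg_left (Real.cosh_strictMonoOn.monotoneOn (Set.Ioi_subset_Ici_self hx)
      (Set.Ioi_subset_Ici_self hy) hxy) zero_le_two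
  rw [← h_image, lintegral_image_eq_lintegral_deriv_mul_of_monotoneOn measurableSet_Ioi
    (fun x _ => ((Real.hasDerivAt_cosh x).const_mul 2).hasDerivWithinAt) h_mono]

lemma lintegral_lintegral_Ioi_comp_add {α : Type*} [MeasurableSpace α] (ν : Measure α) [SFinite ν]
    {φ : α → ℝ} (hφ : Measurable φ) {h : ℝ → ℝ≥0∞} (hh : Measurable h) :
    ∫⁻ u, (∫⁻ a in Set.Ioi 0, h (φ u + a)) ∂ν = ∫⁻ t, h t * ν {u | φ u < t} := by
  have h_meas : MeasurableSet {p : α × ℝ | φ p.1 < p.2} :=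
    measurableSet_lt (by fun_prop) (by fun_prop)
  have h_shift (u : α) : ∫⁻ a in Set.Ioi 0, h (φ u + a) =
      ∫⁻ t, {p : α × ℝ | φ p.1 < p.2}.indicator (fun p => h p.2) (u, t) := by
    rw [lintegral_Ioi_comp_add, ← lintegral_indicator measurableSet_Ioi]
    rfl
  simp only [h_shift]
  rw [lintegral_lintegral_swap]
  · exact lintegral_congr fun t =>
      lintegral_indicator_const (measurableSet_lt hφ measurable_const) (h t)
  · exact ((by fun_prop : Measurable fun p : α × ℝ => h p.2).indicator h_meas).aemeasurable

lemma Ioi_inter_setOf_add_inv_lt_two_mul_cosh {r : ℝ} (hr : 0 ≤ r) :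
    Set.Ioi 0 ∩ {u : ℝ | u + u⁻¹ < 2 * Real.cosh r} = Set.Ioo (Real.exp (-r)) (Real.exp r) := by
  have h_factor {u : ℝ} (hu : 0 < u) : u + u⁻¹ < 2 * Real.cosh r ↔
      (u - Real.exp (-r)) * (u - Real.exp r) < 0 := by
    have h_mul : Real.exp (-r) * Real.exp r = 1 := by rw [← Real.exp_add, neg_add_cancel,
      Real.exp_zero]
    rw [Real.cosh_eq, ← mul_lt_mul_iff_right₀ hu, mul_add, mul_inv_cancel₀ hu.ne', ← sub_neg]
    refine iff_of_eq (congrArg (· < 0) ?_)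
    linear_combination -h_mul
  have h_le : Real.exp (-r) ≤ Real.exp r := Real.exp_le_exp.2 (by linarith)
  ext u
  constructor
  · rintro ⟨hu, h⟩
    rcases mul_neg_iff.1 ((h_factor hu).1 h) with ⟨h1, h2⟩ | ⟨h1, h2⟩
    · exact ⟨sub_pos.1 h1, sub_neg.1 h2⟩
    · linarith
  · rintro ⟨h1, h2⟩
    have hu : 0 < u := (Real.exp_pos _).trans h1
    exact ⟨hu, (h_factor hu).2 (mul_neg_of_pos_of_neg (sub_pos.2 h1) (sub_neg.2 h2))⟩

lemma volume_Ioi_inter_setOf_add_inv_lt_two_mul_cosh {r : ℝ} (hr : 0 ≤ r) :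
    (volume : Measure ℝ) (Set.Ioi 0 ∩ {u : ℝ | u + u⁻¹ < 2 * Real.cosh r}) =
      ENNReal.ofReal (2 * Real.sinh r) := by
  rw [Ioi_inter_setOf_add_inv_lt_two_mul_cosh hr, Real.volume_Ioo, Real.sinh_eq]
  ring_nf

lemma two_le_add_inv {u : ℝ} (hu : 0 < u) : 2 ≤ u + u⁻¹ := by
  have : u * u⁻¹ = 1 := mul_inv_cancel₀ hu.ne'
  nlinarith [sq_nonneg (u - u⁻¹), inv_pos.2 hu]

lemma lintegral_add_inv_add {h : ℝ → ℝ≥0∞} (hh : Measurable h) :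
    ∫⁻ u in Set.Ioi 0, ∫⁻ a in Set.Ioi 0, h (u + u⁻¹ + a) =
      4 * ∫⁻ r in Set.Ioi 0, ENNReal.ofReal (Real.sinh r ^ 2) * h (2 * Real.cosh r) := by
  have h_apply (t : ℝ) : volume.restrict (Set.Ioi 0) {u : ℝ | u + u⁻¹ < t} =
      volume (Set.Ioi 0 ∩ {u | u + u⁻¹ < t}) := by
    rw [Measure.restrict_apply (measurableSet_lt (by fun_prop) measurable_const), Set.inter_comm]
  have h_support (t : ℝ) (ht : t ∉ Set.Ioi 2) :
      h t * volume.restrict (Set.Ioi 0) {u : ℝ | u + u⁻¹ < t} = 0 := by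
    have h_empty : Set.Ioi 0 ∩ {u | u + u⁻¹ < t} = ∅ :=
      Set.eq_empty_of_forall_notMem fun u ⟨hu, hut⟩ => ht ((two_le_add_inv hu).trans_lt hut)
    rw [h_apply, h_empty, measure_empty, mul_zero]
  rw [lintegral_lintegral_Ioi_comp_add _ (by fun_prop) hh,
    ← setLIntegral_eq_of_support_subset (Function.support_subset_iff'.2 h_support),
    lintegral_Ioi_two_eq_cosh, ← lintegral_const_mul' _ _ ENNReal.ofNat_ne_top]
  refine setLIntegral_congr_fun measurableSet_Ioi fun r hr => ?_
  have hr : 0 ≤ r := le_of_lt hr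
  have h_sinh : 0 ≤ 2 * Real.sinh r := mul_nonneg zero_le_two (Real.sinh_nonneg_iff.2 hr)
  have h_four : (4 : ℝ≥0∞) * ENNReal.ofReal (Real.sinh r ^ 2) =
      ENNReal.ofReal (2 * Real.sinh r) * ENNReal.ofReal (2 * Real.sinh r) := by
    rw [← ENNReal.ofReal_mul h_sinh, ← ENNReal.ofReal_ofNat 4, ← ENNReal.ofReal_mul (by norm_num)]
    ring_nf
  simp only [h_apply, volume_Ioi_inter_setOf_add_inv_lt_two_mul_cosh hr]
  rw [← mul_assoc 4, h_four]
  ring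

section NormLaw

open Module

variable {E : Type*} [NormedAddCommGroup E] [NormedSpace ℝ E] [FiniteDimensional ℝ E]
  [Nontrivial E] [MeasurableSpace E] [BorelSpace E] (μ : Measure E) [μ.IsAddHaarMeasure]

lemma lintegral_fun_norm_addHaar {f : ℝ → ℝ≥0∞} (hf : Measurable f) :
    ∫⁻ x, f ‖x‖ ∂μ = finrank ℝ E * μ (Metric.ball 0 1) *
      ∫⁻ y in Set.Ioi 0, ENNReal.ofReal (y ^ (finrank ℝ E - 1)) * f y :=
  calc
    ∫⁻ x, f ‖x‖ ∂μ = ∫⁻ x : ({0}ᶜ : Set E), f ‖x.1‖ ∂μ.comap (↑) := by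
      rw [lintegral_subtype_comap (measurableSet_singleton _).compl fun x => f ‖x‖,
        restrict_compl_singleton]
    _ = ∫⁻ p, f p.2 ∂μ.toSphere.prod (.volumeIoiPow (finrank ℝ E - 1)) := by
      simpa using μ.measurePreserving_homeomorphUnitSphereProd.lintegral_comp
        (f := fun p => f p.2) (by fun_prop)
    _ = μ.toSphere Set.univ * ∫⁻ y : Set.Ioi (0 : ℝ), f y ∂.volumeIoiPow (finrank ℝ E - 1) := by
      rw [lintegral_prod _ (by fun_prop)]
      simp only [lintegral_const, mul_comm]
    _ = _ := by
      rw [μ.toSphere_apply_univ, Measure.volumeIoiPow, lintegral_withDensity_eq_lintegral_mul _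
        (by fun_prop) (by fun_prop)]
      exact congrArg _ (lintegral_subtype_comap measurableSet_Ioi
        fun y => ENNReal.ofReal (y ^ (finrank ℝ E - 1)) * f y)

lemma lintegral_fun_norm_sq_addHaar {m : ℕ} (hE : finrank ℝ E = 2 * (m + 1)) {f : ℝ → ℝ≥0∞}
    (hf : Measurable f) :
    ∫⁻ x, f (‖x‖ ^ 2) ∂μ =
      (m + 1) * μ (Metric.ball 0 1) * ∫⁻ s in Set.Ioi 0, ENNReal.ofReal (s ^ m) * f s := by
  have h_pow (y : ℝ) (hy : y ∈ Set.Ioi 0) : ENNReal.ofReal (y ^ (2 * (m + 1) - 1)) * f (y ^ 2) =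
      ENNReal.ofReal y * (ENNReal.ofReal ((y ^ 2) ^ m) * f (y ^ 2)) := by
    rw [← mul_assoc, ← ENNReal.ofReal_mul (le_of_lt hy), ← pow_mul, ← pow_succ']
    rfl
  rw [lintegral_fun_norm_addHaar μ (f := fun y => f (y ^ 2)) (by fun_prop), hE,
    setLIntegral_congr_fun measurableSet_Ioi h_pow,
    ← two_mul_lintegral_Ioi_mul_comp_sq fun s => ENNReal.ofReal (s ^ m) * f s]
  push_cast
  ring

end NormLaw

end RealIntegrals

section Frobenius

variable {m n 𝕜 : Type*} [Fintype m] [Fintype n] [RCLike 𝕜]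

/-- The square of the Frobenius norm of a matrix. It is spelled out as a sum because the norms on
matrices are not global instances. -/
def frobeniusSq (A : Matrix m n 𝕜) : ℝ := ∑ i, ∑ j, ‖A i j‖ ^ 2

lemma ofReal_frobeniusSq (A : Matrix m n 𝕜) : (frobeniusSq A : 𝕜) = (Aᴴ * A).trace := by
  simp only [frobeniusSq, trace, diag_apply, mul_apply, conjTranspose_apply, RCLike.star_def,
    RCLike.conj_mul, RCLike.ofReal_sum, RCLike.ofReal_pow]
  exact Finset.sum_comm

lemma frobeniusSq_conjTranspose (A : Matrix m n 𝕜) : frobeniusSq Aᴴ = frobeniusSq A := by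
  simp only [frobeniusSq, conjTranspose_apply, norm_star]
  exact Finset.sum_comm

lemma frobeniusSq_unitary_mul [DecidableEq m] {U : Matrix m m 𝕜} (hU : U ∈ unitaryGroup m 𝕜)
    (A : Matrix m n 𝕜) : frobeniusSq (U * A) = frobeniusSq A := by
  refine RCLike.ofReal_injective (K := 𝕜) ?_
  rw [ofReal_frobeniusSq, ofReal_frobeniusSq, conjTranspose_mul, Matrix.mul_assoc,
    ← Matrix.mul_assoc _ U, ← star_eq_conjTranspose U, mem_unitaryGroup_iff'.1 hU, Matrix.one_mul]

lemma frobeniusSq_mul_unitary [DecidableEq n] {U : Matrix n n 𝕜} (hU : U ∈ unitaryGroup n 𝕜)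
    (A : Matrix m n 𝕜) : frobeniusSq (A * U) = frobeniusSq A := by
  rw [← frobeniusSq_conjTranspose, conjTranspose_mul, ← star_eq_conjTranspose U,
    frobeniusSq_unitary_mul (Unitary.star_mem hU), frobeniusSq_conjTranspose]

lemma continuous_frobeniusSq : Continuous (frobeniusSq : Matrix m n 𝕜 → ℝ) := by
  unfold frobeniusSq
  fun_prop

end Frobenius

lemma frobeniusSq_toSL_mul_mul_toSL (k k' : SU2) (g : SL2C) :
    frobeniusSq (toSL k * g * toSL k').1 = frobeniusSq g.1 :=
  (frobeniusSq_mul_unitary k'.2.1 _).trans (frobeniusSq_unitary_mul k.2.1 _)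

lemma frobeniusSq_cartanA (r : ℝ) : frobeniusSq (cartanA r).1 = 2 * Real.cosh r := by
  have h_exp (t : ℝ) : Real.exp (t / 2) ^ 2 = Real.exp t := by
    rw [← Real.exp_nat_mul, Nat.cast_ofNat, mul_div_cancel₀ t two_ne_zero]
  have h_sum : frobeniusSq (cartanA r).1 = Real.exp (r / 2) ^ 2 + Real.exp (-r / 2) ^ 2 := by
    simp [frobeniusSq, cartanA, -Complex.ofReal_exp, neg_div]
  rw [h_sum, h_exp, h_exp, Real.cosh_eq, mul_div_cancel₀ _ two_ne_zero]

section OrbitMap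

lemma measurable_SL2C_iff {X : Type*} [MeasurableSpace X] {f : X → SL2C} :
    Measurable f ↔ ∀ i j, Measurable fun x => (f x).1 i j := by
  have h_emb : Topology.IsClosedEmbedding
      fun g : SL2C => (fun i j => g.1 i j : Fin 2 → Fin 2 → ℂ) :=
    SpecialLinearGroup.isClosedEmbedding_val
  rw [← h_emb.measurableEmbedding.measurable_comp_iff]
  simp only [measurable_pi_iff, Function.comp_def]

lemma measurePreserving_toEuclideanLin {n : Type*} [Fintype n] [DecidableEq n]
    (μ : Measure (EuclideanSpace ℂ n)) [μ.IsAddHaarMeasure] {A : Matrix n n ℂ} (hA : A.det = 1) :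
    MeasurePreserving (toEuclideanLin A) μ μ := by
  let f : EuclideanSpace ℂ n →ₗ[ℝ] EuclideanSpace ℂ n := (toEuclideanLin A).restrictScalars ℝ
  have hf : LinearMap.det f = 1 := by
    have h_det : LinearMap.det (toEuclideanLin A) = 1 := (LinearMap.det_toLpLin 2 A).trans hA
    rw [LinearMap.det_restrictScalars, h_det, map_one]
  have h_map : μ.map f = μ := by
    simpa [hf] using Measure.map_linearMap_addHaar_eq_smul_addHaar μ (f := f) (by simp [hf])
  exact ⟨f.continuous_of_finiteDimensional.measurable, h_map⟩

/-- A matrix of determinant `1` with prescribed first column `v ≠ 0`, the second column being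
orthogonal to the first one; the value at `v = 0` is immaterial. -/
noncomputable def columnSection (v : EuclideanSpace ℂ (Fin 2)) : SL2C :=
  open scoped Classical in
  if hv : v = 0 then 1 else
    ⟨!![v 0, -star (v 1) / (‖v‖ : ℂ) ^ 2; v 1, star (v 0) / (‖v‖ : ℂ) ^ 2], by
      have h_norm : (‖v‖ : ℂ) ^ 2 = v 0 * star (v 0) + v 1 * star (v 1) := by
        rw [← Complex.ofReal_pow, EuclideanSpace.norm_sq_eq, Fin.sum_univ_two]
        simp [Complex.mul_conj']
      have h_ne : (‖v‖ : ℂ) ^ 2 ≠ 0 := by simpa using hv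
      rw [det_fin_two_of, div_mul_eq_mul_div, ← mul_div_assoc, ← sub_div, div_eq_one_iff_eq h_ne,
        h_norm]
      ring⟩

lemma columnSection_val {v : EuclideanSpace ℂ (Fin 2)} (hv : v ≠ 0) : (columnSection v).1 =
    !![v 0, -star (v 1) / (‖v‖ : ℂ) ^ 2; v 1, star (v 0) / (‖v‖ : ℂ) ^ 2] :=
  congrArg Subtype.val (dif_neg hv)

lemma measurable_columnSection : Measurable columnSection := by
  refine measurable_SL2C_iff.2 fun i j => ?_
  have h_entry (v : EuclideanSpace ℂ (Fin 2)) : (columnSection v).1 i j =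
      ({0} : Set _).piecewise (fun _ => (1 : M2) i j)
        (fun v => !![v 0, -star (v 1) / (‖v‖ : ℂ) ^ 2; v 1, star (v 0) / (‖v‖ : ℂ) ^ 2] i j) v := by
    by_cases hv : v = 0
    · simp [columnSection, hv]
    · simp [columnSection_val hv, Set.piecewise, hv]
  simp only [h_entry]
  refine Measurable.piecewise (measurableSet_singleton 0) measurable_const ?_
  fin_cases i <;> fin_cases j <;>
    simp only [of_apply, cons_val', cons_val_zero, cons_val_one, cons_val_fin_one, Fin.zero_eta,
      Fin.mk_one] <;>
    fun_prop

lemma col_zero_columnSection {v : EuclideanSpace ℂ (Fin 2)} (hv : v ≠ 0) :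
    (columnSection v).1.col 0 = v := by
  ext i
  fin_cases i <;> simp [columnSection_val hv]

lemma eq_transvection_of_col_zero {g : SL2C} (hg : g.1.col 0 = Pi.single 0 1) :
    g = SpecialLinearGroup.transvection zero_ne_one (g.1 0 1) := by
  have h00 : g.1 0 0 = 1 := congrFun hg 0
  have h10 : g.1 1 0 = 0 := congrFun hg 1
  have h11 : g.1 1 1 = 1 := by
    have h_det := g.2
    rwa [det_fin_two, h00, h10, mul_zero, sub_zero, one_mul] at h_det
  ext i j
  fin_cases i <;> fin_cases j <;>
    simp [SpecialLinearGroup.transvection_coe, h00, h10, h11]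

end OrbitMap

section HaarMeasure

/-- The chart `(v, t) ↦ σ(v) n(t)` of `SL(2, ℂ)`, where `σ(v)` is `columnSection v` and `n(t)` is
the upper unitriangular matrix with entry `t`, the stabilizer of the first basis vector. -/
noncomputable def orbitChart (p : EuclideanSpace ℂ (Fin 2) × ℂ) : SL2C :=
  columnSection p.1 * SpecialLinearGroup.transvection zero_ne_one p.2

lemma measurable_orbitChart : Measurable orbitChart := by
  have h_transvection : Measurable fun t : ℂ =>
      (SpecialLinearGroup.transvection zero_ne_one t : SL2C) := by
    refine measurable_SL2C_iff.2 fun i j => ?_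
    simp only [SpecialLinearGroup.transvection_coe, Matrix.add_apply, single_apply]
    split_ifs <;> fun_prop
  exact (measurable_columnSection.comp measurable_fst).mul (h_transvection.comp measurable_snd)

/-- The measure on `SL(2, ℂ)` that is Lebesgue measure of `ℂ² × ℂ` in the chart `orbitChart`. -/
noncomputable def haarSL : Measure SL2C :=
  ((volume : Measure (EuclideanSpace ℂ (Fin 2))).prod (volume : Measure ℂ)).map orbitChart

/-- The upper right entry of `σ(g v)⁻¹ g σ(v)`, which is unitriangular: multiplying `orbitChart`
by `g` on the left translates the coordinate `t` by this amount. -/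
noncomputable def orbitCocycle (g : SL2C) (v : EuclideanSpace ℂ (Fin 2)) : ℂ :=
  ((columnSection (toEuclideanLin g.1 v))⁻¹ * g * columnSection v).1 0 1

lemma toEuclideanLin_ne_zero (g : SL2C) {v : EuclideanSpace ℂ (Fin 2)} (hv : v ≠ 0) :
    toEuclideanLin g.1 v ≠ 0 := by
  intro h
  refine hv (WithLp.ofLp_injective 2 (?_ : v.ofLp = 0))
  exact Matrix.eq_zero_of_mulVec_eq_zero (by simp [g.2]) (congrArg WithLp.ofLp h)

lemma mul_columnSection (g : SL2C) {v : EuclideanSpace ℂ (Fin 2)} (hv : v ≠ 0) :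
    g * columnSection v = columnSection (toEuclideanLin g.1 v) *
      SpecialLinearGroup.transvection zero_ne_one (orbitCocycle g v) := by
  set w := toEuclideanLin g.1 v
  have h_col (A : M2) (B : M2) : (A * B).col 0 = A *ᵥ B.col 0 := by
    ext i; rfl
  have h_fix : (columnSection w).1 *ᵥ Pi.single 0 1 = g.1 *ᵥ (columnSection v).1.col 0 := by
    rw [mulVec_single_one, col_zero_columnSection (toEuclideanLin_ne_zero g hv),
      col_zero_columnSection hv]
    rfl
  have h_unipotent : ((columnSection w)⁻¹ * g * columnSection v).1.col 0 = Pi.single 0 1 := by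
    have h_inv : (columnSection w)⁻¹.1 * (columnSection w).1 = 1 :=
      congrArg Subtype.val (inv_mul_cancel (columnSection w))
    change ((columnSection w)⁻¹.1 * g.1 * (columnSection v).1).col 0 = Pi.single 0 1
    rw [Matrix.mul_assoc, h_col, h_col, ← h_fix, mulVec_mulVec, h_inv, one_mulVec]
  rw [orbitCocycle, ← eq_transvection_of_col_zero h_unipotent]
  group

lemma mul_orbitChart (g : SL2C) {v : EuclideanSpace ℂ (Fin 2)} (hv : v ≠ 0) (t : ℂ) :
    g * orbitChart (v, t) = orbitChart (toEuclideanLin g.1 v, orbitCocycle g v + t) := by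
  simp only [orbitChart]
  rw [← mul_assoc, mul_columnSection g hv, mul_assoc]
  exact congrArg _ (Subtype.ext (transvection_mul_transvection_same 0 1 zero_ne_one _ _))

lemma measurable_orbitCocycle (g : SL2C) : Measurable (orbitCocycle g) := by
  have h_lin : Measurable (toEuclideanLin g.1) :=
    (measurePreserving_toEuclideanLin volume g.2).measurable
  have h : Measurable fun v => (columnSection (toEuclideanLin g.1 v))⁻¹ * g * columnSection v :=
    ((measurable_columnSection.comp h_lin).inv.mul_const g).mul measurable_columnSection
  exact measurable_SL2C_iff.1 h 0 1

instance isMulLeftInvariant_haarSL : haarSL.IsMulLeftInvariant where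
  map_mul_left_eq_self g := by
    have h_skew : MeasurePreserving
        (fun p : EuclideanSpace ℂ (Fin 2) × ℂ => (toEuclideanLin g.1 p.1, orbitCocycle g p.1 + p.2))
        (volume.prod volume) (volume.prod volume) :=
      (measurePreserving_toEuclideanLin volume g.2).skew_product
        (((measurable_orbitCocycle g).comp measurable_fst).add measurable_snd)
        (Filter.Eventually.of_forall fun v => map_add_left_eq_self volume (orbitCocycle g v))
    have h_ne : ∀ᵐ p ∂(volume : Measure (EuclideanSpace ℂ (Fin 2))).prod (volume : Measure ℂ),
        p.1 ≠ 0 := Measure.quasiMeasurePreserving_fst.ae (Measure.ae_ne volume 0)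
    calc
      haarSL.map (g * ·) = (volume.prod volume).map fun p => g * orbitChart p :=
        Measure.map_map (measurable_const_mul g) measurable_orbitChart
      _ = (volume.prod volume).map
          fun p => orbitChart (toEuclideanLin g.1 p.1, orbitCocycle g p.1 + p.2) :=
        Measure.map_congr (h_ne.mono fun p hp => mul_orbitChart g hp p.2)
      _ = haarSL := by
        conv_rhs => rw [haarSL, ← h_skew.map_eq]
        exact (Measure.map_map measurable_orbitChart h_skew.measurable).symm

lemma norm_sq_sub_star_add_norm_sq_add_star (a b s t : ℂ) :
    ‖a * t - star b * s‖ ^ 2 + ‖b * t + star a * s‖ ^ 2 =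
      (‖a‖ ^ 2 + ‖b‖ ^ 2) * (‖t‖ ^ 2 + ‖s‖ ^ 2) := by
  simp only [Complex.sq_norm, Complex.normSq_apply, Complex.sub_re, Complex.sub_im, Complex.add_re,
    Complex.add_im, Complex.mul_re, Complex.mul_im, Complex.star_def, Complex.conj_re,
    Complex.conj_im]
  ring

lemma frobeniusSq_orbitChart {v : EuclideanSpace ℂ (Fin 2)} (hv : v ≠ 0) (t : ℂ) :
    frobeniusSq (orbitChart (v, t)).1 = ‖v‖ ^ 2 + (‖v‖ ^ 2)⁻¹ + ‖v‖ ^ 2 * ‖t‖ ^ 2 := by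
  set s : ℂ := (((‖v‖ ^ 2)⁻¹ : ℝ) : ℂ) with hs
  have h_norm : ‖v 0‖ ^ 2 + ‖v 1‖ ^ 2 = ‖v‖ ^ 2 := by
    rw [EuclideanSpace.norm_sq_eq, Fin.sum_univ_two]
  have h_val : (orbitChart (v, t)).1 =
      !![v 0, v 0 * t - star (v 1) * s; v 1, v 1 * t + star (v 0) * s] := by
    have h_s : s = ((‖v‖ : ℂ) ^ 2)⁻¹ := by rw [hs, Complex.ofReal_inv, Complex.ofReal_pow]
    change (columnSection v).1 * (1 + single 0 1 t) = _
    rw [columnSection_val hv, h_s]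
    ext i j
    fin_cases i <;> fin_cases j <;> simp [mul_add, mul_apply, div_eq_mul_inv]
    ring
  have h_s_norm : ‖s‖ ^ 2 = (‖v‖ ^ 2)⁻¹ ^ 2 := by
    rw [hs, Complex.norm_real, Real.norm_eq_abs, sq_abs]
  have h_sum : frobeniusSq (orbitChart (v, t)).1 = ‖v 0‖ ^ 2 + ‖v 1‖ ^ 2 +
      (‖v 0 * t - star (v 1) * s‖ ^ 2 + ‖v 1 * t + star (v 0) * s‖ ^ 2) := by
    rw [h_val]
    simp only [frobeniusSq, Fin.sum_univ_two, of_apply, cons_val_zero, cons_val_one]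
    ring
  have h_ne : ‖v‖ ^ 2 ≠ 0 := pow_ne_zero 2 (norm_ne_zero_iff.2 hv)
  rw [h_sum, norm_sq_sub_star_add_norm_sq_add_star, h_norm, h_s_norm, mul_add, sq (‖v‖ ^ 2)⁻¹,
    mul_inv_cancel_left₀ h_ne]
  ring

/-- The constant in the radial law `lintegral_frobeniusSq_haarSL` of `haarSL`. -/
noncomputable def radialConst : ℝ≥0∞ :=
  8 * volume (Metric.ball (0 : EuclideanSpace ℂ (Fin 2)) 1) * volume (Metric.ball (0 : ℂ) 1)

lemma radialConst_ne_zero : radialConst ≠ 0 :=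
  mul_ne_zero (mul_ne_zero (by norm_num) (Metric.measure_ball_pos volume _ one_pos).ne')
    (Metric.measure_ball_pos volume _ one_pos).ne'

lemma radialConst_ne_top : radialConst ≠ ∞ :=
  ENNReal.mul_ne_top (ENNReal.mul_ne_top (by norm_num) measure_ball_lt_top.ne)
    measure_ball_lt_top.ne

lemma lintegral_comp_frobeniusSq_orbitChart {h : ℝ → ℝ≥0∞} (hh : Measurable h)
    {v : EuclideanSpace ℂ (Fin 2)} (hv : v ≠ 0) :
    ∫⁻ t, h (frobeniusSq (orbitChart (v, t)).1) = volume (Metric.ball (0 : ℂ) 1) *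
      ∫⁻ s in Set.Ioi 0, h (‖v‖ ^ 2 + (‖v‖ ^ 2)⁻¹ + ‖v‖ ^ 2 * s) := by
  simp only [frobeniusSq_orbitChart hv]
  rw [lintegral_fun_norm_sq_addHaar (volume : Measure ℂ) (m := 0) Complex.finrank_real_complex
    (f := fun s => h (‖v‖ ^ 2 + (‖v‖ ^ 2)⁻¹ + ‖v‖ ^ 2 * s)) (by fun_prop)]
  simp only [Nat.cast_zero, zero_add, one_mul, pow_zero, ENNReal.ofReal_one]

lemma continuous_frobeniusSq_val : Continuous fun g : SL2C => frobeniusSq g.1 :=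
  continuous_frobeniusSq.comp continuous_subtype_val

lemma lintegral_frobeniusSq_haarSL {h : ℝ → ℝ≥0∞} (hh : Measurable h) :
    ∫⁻ g, h (frobeniusSq g.1) ∂haarSL = radialConst *
      ∫⁻ r in Set.Ioi 0, ENNReal.ofReal (Real.sinh r ^ 2) * h (2 * Real.cosh r) := by
  have h_meas : Measurable fun g : SL2C => h (frobeniusSq g.1) :=
    hh.comp continuous_frobeniusSq_val.measurable
  have h_finrank : Module.finrank ℝ (EuclideanSpace ℂ (Fin 2)) = 2 * (1 + 1) := by
    rw [finrank_real_of_complex, finrank_euclideanSpace_fin]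
  have h_scale (u : ℝ) (hu : u ∈ Set.Ioi 0) :
      ENNReal.ofReal (u ^ 1) * ∫⁻ s in Set.Ioi 0, h (u + u⁻¹ + u * s) =
        ∫⁻ a in Set.Ioi 0, h (u + u⁻¹ + a) := by
    rw [pow_one, mul_lintegral_Ioi_comp_mul hu fun a => h (u + u⁻¹ + a)]
  have h_F : Measurable fun u : ℝ => ∫⁻ s in Set.Ioi 0, h (u + u⁻¹ + u * s) :=
    (by fun_prop : Measurable fun p : ℝ × ℝ => h (p.1 + p.1⁻¹ + p.1 * p.2)).lintegral_prod_right'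
  rw [haarSL, lintegral_map h_meas measurable_orbitChart,
    lintegral_prod (fun p => h (frobeniusSq (orbitChart p).1))
      (h_meas.comp measurable_orbitChart).aemeasurable,
    lintegral_congr_ae ((Measure.ae_ne volume 0).mono
      fun v hv => lintegral_comp_frobeniusSq_orbitChart hh hv),
    lintegral_const_mul' _ _ measure_ball_lt_top.ne,
    lintegral_fun_norm_sq_addHaar volume (m := 1) h_finrank h_F,
    setLIntegral_congr_fun measurableSet_Ioi h_scale, lintegral_add_inv_add hh, radialConst]
  push_cast
  ring

instance : IsFiniteMeasureOnCompacts haarSL where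
  lt_top_of_isCompact K hK := by
    obtain ⟨R, hR⟩ := hK.bddAbove_image continuous_frobeniusSq_val.continuousOn
    have h_preimage : MeasurableSet ((fun g : SL2C => frobeniusSq g.1) ⁻¹' Set.Iic R) :=
      continuous_frobeniusSq_val.measurable measurableSet_Iic
    have h_le (r : ℝ) (hr : r ∈ Set.Ioi 0) : ENNReal.ofReal (Real.sinh r ^ 2) *
        (Set.Iic R).indicator 1 (2 * Real.cosh r) ≤
          (Set.Iic R).indicator (fun r => ENNReal.ofReal (Real.sinh r ^ 2)) r := by
      by_cases hrR : 2 * Real.cosh r ≤ R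
      · have h_mem : r ∈ Set.Iic R := by
          have h_self := Real.self_le_sinh_iff.2 (le_of_lt hr)
          exact Set.mem_Iic.2 (by linarith [Real.sinh_lt_cosh r, Real.cosh_pos r])
        simp [h_mem, hrR]
      · simp [hrR]
    have h_bound : ∫⁻ r in Set.Ioi 0, ENNReal.ofReal (Real.sinh r ^ 2) *
        (Set.Iic R).indicator 1 (2 * Real.cosh r) ≤
          ∫⁻ r in Set.Icc 0 R, ENNReal.ofReal (Real.sinh r ^ 2) := by
      refine (setLIntegral_mono' measurableSet_Ioi h_le).trans ?_
      rw [setLIntegral_indicator measurableSet_Iic, Set.inter_comm, Set.Ioi_inter_Iic]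
      exact lintegral_mono_set Set.Ioc_subset_Icc_self
    calc
      haarSL K ≤ haarSL ((fun g : SL2C => frobeniusSq g.1) ⁻¹' Set.Iic R) :=
        measure_mono fun g hg => hR (Set.mem_image_of_mem _ hg)
      _ = ∫⁻ g, (Set.Iic R).indicator 1 (frobeniusSq g.1) ∂haarSL := by
        rw [← lintegral_indicator_one h_preimage]
        rfl
      _ = radialConst * ∫⁻ r in Set.Ioi 0, ENNReal.ofReal (Real.sinh r ^ 2) *
            (Set.Iic R).indicator 1 (2 * Real.cosh r) :=
        lintegral_frobeniusSq_haarSL (measurable_one.indicator measurableSet_Iic)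
      _ ≤ radialConst * ∫⁻ r in Set.Icc 0 R, ENNReal.ofReal (Real.sinh r ^ 2) := by gcongr
      _ < ∞ := ENNReal.mul_lt_top radialConst_ne_top.lt_top
        (Continuous.integrableOn_Icc (by fun_prop)).lintegral_lt_top

instance : NeZero haarSL :=
  ⟨(Measure.map_ne_zero_iff measurable_orbitChart.aemeasurable).2 (NeZero.ne _)⟩

instance : haarSL.IsHaarMeasure where
  __ := isMulLeftInvariant_haarSL
  __ := isOpenPosMeasure_of_mulLeftInvariant_of_regular

instance : haarSL.IsMulRightInvariant :=
  isMulRightInvariant_of_commutator_eq_top haarSL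
    (Matrix.SL2.commutator_eq_top (a := 2) (by norm_num) (by norm_num))

end HaarMeasure

section CartanDecomposition

lemma exists_specialUnitary_conj_eq_diagonal {n 𝕜 : Type*} [Fintype n] [DecidableEq n] [RCLike 𝕜]
    {H : Matrix n n 𝕜} (hH : H.IsHermitian) :
    ∃ U ∈ specialUnitaryGroup n 𝕜, ∃ d : n → ℝ, Uᴴ * H * U = diagonal fun i => (d i : 𝕜) := by
  rcases isEmpty_or_nonempty n with _ | ⟨⟨i₀⟩⟩
  · exact ⟨1, one_mem _, 0, Subsingleton.elim _ _⟩
  set U : Matrix n n 𝕜 := hH.eigenvectorUnitary.1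
  have hU : Uᴴ * U = 1 := mem_unitaryGroup_iff'.1 hH.eigenvectorUnitary.2
  have h_diag : Uᴴ * H * U = diagonal fun i => (hH.eigenvalues i : 𝕜) := by
    have h := hH.conjStarAlgAut_star_eigenvectorUnitary
    rwa [Unitary.conjStarAlgAut_star_apply] at h
  have h_det : star U.det * U.det = 1 := by rw [← det_conjTranspose, ← det_mul, hU, det_one]
  set D : Matrix n n 𝕜 := diagonal (Pi.mulSingle i₀ (star U.det))
  have hD : Dᴴ * D = 1 := by
    have h_mul : star (Pi.mulSingle i₀ (star U.det)) * Pi.mulSingle i₀ (star U.det) =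
        (1 : n → 𝕜) := by
      rw [Pi.star_mulSingle, star_star, ← Pi.mulSingle_mul, mul_comm, h_det, Pi.mulSingle_one]
    rw [diagonal_conjTranspose, diagonal_mul_diagonal']
    exact (congrArg diagonal h_mul).trans diagonal_one
  refine ⟨U * D, mem_specialUnitaryGroup_iff_conjTranspose_mul.2 ⟨?_, ?_⟩, hH.eigenvalues, ?_⟩
  · rw [conjTranspose_mul, Matrix.mul_assoc, ← Matrix.mul_assoc Uᴴ, hU, Matrix.one_mul, hD]
  · rw [det_mul, det_diagonal, Finset.prod_pi_mulSingle', if_pos (Finset.mem_univ _), mul_comm,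
      h_det]
  · calc
      (U * D)ᴴ * H * (U * D) = Dᴴ * (Uᴴ * H * U * D) := by
        simp only [conjTranspose_mul, Matrix.mul_assoc]
      _ = Dᴴ * (D * (Uᴴ * H * U)) := by rw [h_diag, (commute_diagonal _ _).eq]
      _ = diagonal fun i => (hH.eigenvalues i : 𝕜) := by
        rw [← Matrix.mul_assoc, hD, Matrix.one_mul, h_diag]

lemma mul_inv_mem_specialUnitaryGroup {n 𝕜 : Type*} [Fintype n] [DecidableEq n] [RCLike 𝕜]
    {g h : SpecialLinearGroup n 𝕜} (hgh : g.1ᴴ * g.1 = h.1ᴴ * h.1) :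
    (g * h⁻¹).1 ∈ specialUnitaryGroup n 𝕜 := by
  have h_inv : h.1 * h⁻¹.1 = 1 := congrArg Subtype.val (mul_inv_cancel h)
  refine mem_specialUnitaryGroup_iff_conjTranspose_mul.2 ⟨?_, (g * h⁻¹).2⟩
  calc
    (g.1 * h⁻¹.1)ᴴ * (g.1 * h⁻¹.1) = h⁻¹.1ᴴ * (g.1ᴴ * g.1) * h⁻¹.1 := by
      simp only [conjTranspose_mul, Matrix.mul_assoc]
    _ = (h.1 * h⁻¹.1)ᴴ * (h.1 * h⁻¹.1) := by
      rw [hgh]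
      simp only [conjTranspose_mul, Matrix.mul_assoc]
    _ = 1 := by rw [h_inv, conjTranspose_one, Matrix.one_mul]

/-- The inclusion of `SU(2)` into `SL(2, ℂ)` as a group homomorphism. -/
def toSLHom : SU2 →* SL2C where
  toFun := toSL
  map_one' := rfl
  map_mul' _ _ := rfl

/-- The Weyl element of `SU(2)`; conjugation by it inverts the diagonal matrices `A_r`. -/
def weylElement : SU2 :=
  ⟨!![0, 1; -1, 0], mem_specialUnitaryGroup_iff_conjTranspose_mul.2 ⟨by
    ext i j
    fin_cases i <;> fin_cases j <;> simp [mul_apply], by simp [det_fin_two]⟩⟩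

lemma toSL_weylElement_mul_cartanA (r : ℝ) :
    toSL weylElement * cartanA r = cartanA (-r) * toSL weylElement := by
  ext i j
  change (weylElement.1 * (cartanA r).1) i j = ((cartanA (-r)).1 * weylElement.1) i j
  fin_cases i <;> fin_cases j <;> simp [weylElement, cartanA, mul_apply, neg_div]

lemma conjTranspose_mul_self_cartanA (r : ℝ) : (cartanA r).1ᴴ * (cartanA r).1 =
    diagonal ![((Real.exp r : ℝ) : ℂ), ((Real.exp (-r) : ℝ) : ℂ)] := by
  ext i j
  fin_cases i <;> fin_cases j <;>
    simp [cartanA, mul_apply, ← neg_add, -neg_add_rev, -Complex.ofReal_exp, ← Complex.ofReal_mul,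
      ← Real.exp_add]

open scoped ComplexOrder in
lemma exists_conjTranspose_mul_self_mul_toSL (g : SL2C) : ∃ (k : SU2) (r : ℝ),
    (g * toSL k).1ᴴ * (g * toSL k).1 = (cartanA r).1ᴴ * (cartanA r).1 := by
  obtain ⟨U, hU, d, hd⟩ :=
    exists_specialUnitary_conj_eq_diagonal (isHermitian_conjTranspose_mul_self g.1)
  set k : SU2 := ⟨U, hU⟩
  have h_gram : (g * toSL k).1ᴴ * (g * toSL k).1 = diagonal fun i => (d i : ℂ) := by
    refine Eq.trans ?_ hd
    change (g.1 * U)ᴴ * (g.1 * U) = _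
    simp only [conjTranspose_mul, Matrix.mul_assoc]
  have h_prod : d 0 * d 1 = 1 := by
    have h_det := congrArg det h_gram
    rw [det_mul, det_conjTranspose, (g * toSL k).2, det_diagonal, Fin.prod_univ_two, star_one,
      one_mul] at h_det
    exact_mod_cast h_det.symm
  have h_nonneg : 0 ≤ d 0 := by
    have h := (posSemidef_conjTranspose_mul_self (g * toSL k).1).diag_nonneg (i := 0)
    rw [h_gram, diagonal_apply_eq] at h
    exact_mod_cast h
  have h_pos : 0 < d 0 := h_nonneg.lt_of_ne (left_ne_zero_of_mul_eq_one h_prod).symm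
  refine ⟨k, Real.log (d 0), ?_⟩
  rw [h_gram, conjTranspose_mul_self_cartanA, Real.exp_neg, Real.exp_log h_pos,
    inv_eq_of_mul_eq_one_right h_prod]
  congr 1
  ext i
  fin_cases i <;> rfl

lemma exists_eq_toSL_mul_cartanA_mul_toSL (g : SL2C) :
    ∃ (k k' : SU2) (r : ℝ), g = toSL k * cartanA r * toSL k' := by
  obtain ⟨k, r, h⟩ := exists_conjTranspose_mul_self_mul_toSL g
  refine ⟨⟨_, mul_inv_mem_specialUnitaryGroup h⟩, k⁻¹, r, ?_⟩
  change g = g * toSL k * (cartanA r)⁻¹ * cartanA r * toSLHom k⁻¹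
  rw [map_inv, inv_mul_cancel_right]
  exact (mul_inv_cancel_right g (toSL k)).symm

lemma surjective_kak : Function.Surjective kak := by
  intro g
  obtain ⟨k, k', r, rfl⟩ := exists_eq_toSL_mul_cartanA_mul_toSL g
  rcases le_total 0 r with hr | hr
  · exact ⟨(k, ⟨r, hr⟩, k'), rfl⟩
  · refine ⟨(k * weylElement⁻¹, ⟨-r, neg_nonneg.2 hr⟩, weylElement * k'), ?_⟩
    change toSLHom (k * weylElement⁻¹) * cartanA (-r) * toSLHom (weylElement * k') =
      toSLHom k * cartanA r * toSLHom k'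
    have h_weyl : toSLHom weylElement * cartanA r = cartanA (-r) * toSLHom weylElement :=
      toSL_weylElement_mul_cartanA r
    rw [map_mul, map_mul, map_inv, ← mul_assoc, mul_assoc _ (cartanA (-r)), ← h_weyl]
    simp only [mul_assoc, inv_mul_cancel_left]

end CartanDecomposition

section ProductMeasures

variable {X Y Z : Type*} [MeasurableSpace X] [MeasurableSpace Y] [MeasurableSpace Z]
  (μ : Measure X) (ν : Measure Y) (μ' : Measure Z) [SFinite ν] [SFinite μ']

lemma prod_prod_withDensity_middle {d : Y → ℝ≥0∞} (hd : Measurable d) :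
    (μ.prod (ν.prod μ')).withDensity (fun p => d p.2.1) =
      μ.prod ((ν.withDensity d).prod μ') := by
  rw [prod_withDensity_left hd, prod_withDensity_right (by exact hd.comp measurable_fst)]

lemma lintegral_prod_prod_middle [SFinite μ] {f : X × Y × Z → ℝ≥0∞} (hf : Measurable f) :
    ∫⁻ p, f p ∂μ.prod (ν.prod μ') = ∫⁻ y, ∫⁻ x, ∫⁻ z, f (x, y, z) ∂μ' ∂μ ∂ν := by
  have h_inner (x : X) : ∫⁻ q, f (x, q) ∂ν.prod μ' = ∫⁻ y, ∫⁻ z, f (x, y, z) ∂μ' ∂ν :=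
    lintegral_prod _ (by fun_prop)
  rw [lintegral_prod _ hf.aemeasurable, lintegral_congr h_inner]
  have h_meas : Measurable fun q : (X × Y) × Z => f (q.1.1, q.1.2, q.2) := by fun_prop
  exact lintegral_lintegral_swap h_meas.lintegral_prod_right'.aemeasurable

end ProductMeasures

section CartanMeasure

lemma lintegral_lebesgueIci (a : ℝ) (f : ℝ → ℝ≥0∞) :
    ∫⁻ x, f x ∂lebesgueIci a = ∫⁻ x in Set.Ioi a, f x :=
  (lintegral_subtype_comap measurableSet_Ici f).trans (setLIntegral_congr Ioi_ae_eq_Ici.symm)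

instance (a : ℝ) : SigmaFinite (lebesgueIci a) := by
  have h_coe := MeasurableEmbedding.subtype_coe (measurableSet_Ici (a := a))
  refine SigmaFinite.of_map (f := Subtype.val) _ h_coe.measurable.aemeasurable ?_
  rw [lebesgueIci, h_coe.map_comap]
  infer_instance

lemma continuous_toSL : Continuous toSL :=
  continuous_subtype_val.subtype_mk _

lemma continuous_cartanA : Continuous cartanA := by
  refine Continuous.subtype_mk (continuous_matrix fun i j => ?_) _
  fin_cases i <;> fin_cases j <;>
    simp only [of_apply, cons_val', cons_val_zero, cons_val_one, cons_val_fin_one, Fin.zero_eta,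
      Fin.mk_one] <;>
    fun_prop

lemma continuous_kak : Continuous kak := by
  have h_toSL := continuous_toSL
  have h_cartanA := continuous_cartanA
  unfold kak
  fun_prop

lemma measurable_ofReal_sinh_sq :
    Measurable fun r : Set.Ici (0 : ℝ) => ENNReal.ofReal (Real.sinh (r : ℝ) ^ 2) := by
  fun_prop

lemma lintegral_cartanMeasure (μ μ' : Measure SU2) [SFinite μ] [SFinite μ'] {f : SL2C → ℝ≥0∞}
    (hf : Measurable f) :
    ∫⁻ p, f (kak p) ∂cartanMeasure μ μ' = ∫⁻ r in Set.Ioi 0,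
      ENNReal.ofReal (Real.sinh r ^ 2) * biAverage toSLHom μ μ' f (cartanA r) := by
  have h_avg : Measurable fun r : Set.Ici (0 : ℝ) => biAverage toSLHom μ μ' f (cartanA r) :=
    (measurable_biAverage continuous_toSL.measurable hf μ μ').comp
      (continuous_cartanA.measurable.comp measurable_subtype_coe)
  rw [cartanMeasure, prod_prod_withDensity_middle _ _ _ measurable_ofReal_sinh_sq,
    lintegral_prod_prod_middle _ _ _ (f := fun p => f (kak p)) (hf.comp continuous_kak.measurable),
    ← lintegral_lebesgueIci 0
      fun r => ENNReal.ofReal (Real.sinh r ^ 2) * biAverage toSLHom μ μ' f (cartanA r)]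
  exact lintegral_withDensity_eq_lintegral_mul _ measurable_ofReal_sinh_sq h_avg

variable (μ μ' : Measure SU2) [μ.IsHaarMeasure] [μ'.IsHaarMeasure]

lemma biAverage_eq_arcosh_frobeniusSq (f : SL2C → ℝ≥0∞) (g : SL2C) :
    biAverage toSLHom μ μ' f g =
      biAverage toSLHom μ μ' f (cartanA (Real.arcosh (frobeniusSq g.1 / 2))) := by
  have := isMulRightInvariant_of_compactSpace μ
  obtain ⟨⟨k, ⟨r, hr⟩, k'⟩, rfl⟩ := surjective_kak g
  have h_norm : frobeniusSq (kak (k, ⟨r, hr⟩, k')).1 = 2 * Real.cosh r :=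
    (frobeniusSq_toSL_mul_mul_toSL k k' _).trans (frobeniusSq_cartanA r)
  rw [h_norm, mul_div_cancel_left₀ _ two_ne_zero, Real.arcosh_cosh hr]
  exact biAverage_map_mul_mul_map toSLHom μ μ' f (cartanA r) k k'

lemma smul_haarSL_eq_smul_map_kak :
    (μ Set.univ * μ' Set.univ) • haarSL = radialConst • (cartanMeasure μ μ').map kak := by
  refine Measure.ext_of_lintegral _ fun f hf => ?_
  have h_radial : Measurable fun t : ℝ =>
      biAverage toSLHom μ μ' f (cartanA (Real.arcosh (t / 2))) := by
    have h_arcosh : Measurable Real.arcosh := by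
      unfold Real.arcosh
      fun_prop
    exact (measurable_biAverage continuous_toSL.measurable hf μ μ').comp
      (continuous_cartanA.measurable.comp (by fun_prop))
  calc
    ∫⁻ g, f g ∂((μ Set.univ * μ' Set.univ) • haarSL) =
        ∫⁻ g, biAverage toSLHom μ μ' f g ∂haarSL := by
      rw [lintegral_smul_measure, smul_eq_mul,
        lintegral_biAverage continuous_toSL.measurable hf]
    _ = ∫⁻ g, biAverage toSLHom μ μ' f (cartanA (Real.arcosh (frobeniusSq g.1 / 2))) ∂haarSL :=
      lintegral_congr (biAverage_eq_arcosh_frobeniusSq μ μ' f)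
    _ = radialConst * ∫⁻ r in Set.Ioi 0, ENNReal.ofReal (Real.sinh r ^ 2) *
        biAverage toSLHom μ μ' f (cartanA r) := by
      rw [lintegral_frobeniusSq_haarSL h_radial]
      refine congrArg _ (setLIntegral_congr_fun measurableSet_Ioi fun r hr => ?_)
      simp only [mul_div_cancel_left₀ (Real.cosh r) (two_ne_zero' ℝ),
        Real.arcosh_cosh (le_of_lt hr)]
    _ = ∫⁻ g, f g ∂(radialConst • (cartanMeasure μ μ').map kak) := by
      rw [lintegral_smul_measure, smul_eq_mul, lintegral_map hf continuous_kak.measurable,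
        lintegral_cartanMeasure μ μ' hf]

lemma map_kak_eq_smul_haarSL : (cartanMeasure μ μ').map kak =
    (radialConst⁻¹ * (μ Set.univ * μ' Set.univ)) • haarSL := by
  rw [mul_smul, smul_haarSL_eq_smul_map_kak, smul_smul,
    ENNReal.inv_mul_cancel radialConst_ne_zero radialConst_ne_top, one_smul]

instance isHaarMeasure_map_kak : ((cartanMeasure μ μ').map kak).IsHaarMeasure := by
  rw [map_kak_eq_smul_haarSL]
  refine Measure.IsHaarMeasure.smul _ (mul_ne_zero (ENNReal.inv_ne_zero.2 radialConst_ne_top)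
    (mul_ne_zero ?_ ?_)) (ENNReal.mul_ne_top (ENNReal.inv_ne_top.2 radialConst_ne_zero)
      (ENNReal.mul_ne_top (measure_ne_top _ _) (measure_ne_top _ _)))
  · exact Measure.measure_univ_ne_zero.2 (NeZero.ne μ)
  · exact Measure.measure_univ_ne_zero.2 (NeZero.ne μ')

instance isMulRightInvariant_map_kak : ((cartanMeasure μ μ').map kak).IsMulRightInvariant := by
  rw [map_kak_eq_smul_haarSL]
  infer_instance

end CartanMeasure

section ExponentialCoordinate

lemma cartanAx_expHalf (r : Set.Ici (0 : ℝ)) : cartanAx (expHalf r) = cartanA r := by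
  apply Subtype.ext
  simp [cartanAx, cartanA, expHalf, Real.exp_neg]

lemma kakx_expHalf (p : SU2 × Set.Ici (0 : ℝ) × SU2) :
    kakx (Prod.map id (Prod.map expHalf id) p) = kak p := by
  simp [kakx, kak, cartanAx_expHalf]

lemma bijective_expHalf : Function.Bijective expHalf := by
  refine ⟨fun r s h => ?_, fun ⟨x, hx⟩ => ?_⟩
  · have h_exp := Real.exp_injective (congrArg Subtype.val h)
    exact Subtype.ext (by linarith)
  · refine ⟨⟨2 * Real.log x, mul_nonneg zero_le_two (Real.log_nonneg hx)⟩, Subtype.ext ?_⟩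
    change Real.exp (2 * Real.log x / 2) = x
    rw [mul_div_cancel_left₀ _ two_ne_zero, Real.exp_log (zero_lt_one.trans_le hx)]

lemma continuous_expHalf : Continuous expHalf :=
  Continuous.subtype_mk (by fun_prop) _

lemma continuous_cartanAx : Continuous cartanAx := by
  have h_inv : Continuous fun x : Set.Ici (1 : ℝ) => (x : ℝ)⁻¹ :=
    continuous_subtype_val.inv₀ fun x => (zero_lt_one.trans_le x.2).ne'
  refine Continuous.subtype_mk (continuous_matrix fun i j => ?_) _
  fin_cases i <;> fin_cases j
  exacts [Complex.continuous_ofReal.comp continuous_subtype_val, continuous_const,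
    continuous_const, Complex.continuous_ofReal.comp h_inv]

lemma continuous_kakx : Continuous kakx := by
  have h_toSL := continuous_toSL
  have h_cartanAx := continuous_cartanAx
  unfold kakx
  fun_prop

lemma exp_half_image_Ioi : (fun r : ℝ => Real.exp (r / 2)) '' Set.Ioi 0 = Set.Ioi 1 := by
  ext x
  constructor
  · rintro ⟨r, hr, rfl⟩
    exact Real.one_lt_exp_iff.2 (half_pos hr)
  · intro hx
    refine ⟨2 * Real.log x, mul_pos two_pos (Real.log_pos hx), ?_⟩
    simp only [mul_div_cancel_left₀ _ (two_ne_zero' ℝ)]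
    exact Real.exp_log (zero_lt_one.trans hx)

lemma deriv_exp_half_mul_density (r : ℝ) :
    Real.exp (r / 2) * (1 / 2) * (2 * ((Real.exp (r / 2) ^ 2 - (Real.exp (r / 2) ^ 2)⁻¹) / 2) ^ 2 *
      (Real.exp (r / 2))⁻¹) = Real.sinh r ^ 2 := by
  have h_sq : Real.exp (r / 2) ^ 2 = Real.exp r := by
    rw [← Real.exp_nat_mul]
    push_cast
    rw [mul_div_cancel₀ _ two_ne_zero]
  rw [h_sq, ← Real.exp_neg r, ← Real.sinh_eq]
  field_simp

lemma setLIntegral_density_eq_setLIntegral_sinh_sq (F : ℝ → ℝ≥0∞) :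
    ∫⁻ x in Set.Ioi 1, ENNReal.ofReal (2 * ((x ^ 2 - (x ^ 2)⁻¹) / 2) ^ 2 * x⁻¹) * F x =
      ∫⁻ r in Set.Ioi 0, ENNReal.ofReal (Real.sinh r ^ 2) * F (Real.exp (r / 2)) := by
  have h_inj : Set.InjOn (fun r : ℝ => Real.exp (r / 2)) (Set.Ioi 0) := fun r _ s _ h => by
    linarith [Real.exp_injective h]
  rw [← exp_half_image_Ioi, lintegral_image_eq_lintegral_abs_deriv_mul measurableSet_Ioi
    (fun r _ => ((hasDerivAt_id' r).div_const 2).exp.hasDerivWithinAt) h_inj]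
  refine setLIntegral_congr_fun measurableSet_Ioi fun r _ => ?_
  rw [← mul_assoc, ← ENNReal.ofReal_mul (abs_nonneg _), abs_of_pos (by positivity),
    deriv_exp_half_mul_density]

lemma measurable_ofReal_density : Measurable fun x : Set.Ici (1 : ℝ) => ENNReal.ofReal
    (2 * (((x : ℝ) ^ 2 - ((x : ℝ) ^ 2)⁻¹) / 2) ^ 2 * (x : ℝ)⁻¹) := by
  fun_prop

lemma map_expHalf_withDensity :
    ((lebesgueIci 0).withDensity fun r => ENNReal.ofReal (Real.sinh (r : ℝ) ^ 2)).map expHalf =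
      (lebesgueIci 1).withDensity fun x => ENNReal.ofReal
        (2 * (((x : ℝ) ^ 2 - ((x : ℝ) ^ 2)⁻¹) / 2) ^ 2 * (x : ℝ)⁻¹) := by
  refine Measure.ext_of_lintegral _ fun f hf => ?_
  have hf_ext (x : Set.Ici (1 : ℝ)) : f (Set.projIci 1 x) = f x := by rw [Set.projIci_coe]
  have h_sinh := lintegral_lebesgueIci 0 fun r =>
    ENNReal.ofReal (Real.sinh r ^ 2) * f (Set.projIci 1 (Real.exp (r / 2)))
  have h_dens := lintegral_lebesgueIci 1 fun x =>
    ENNReal.ofReal (2 * ((x ^ 2 - (x ^ 2)⁻¹) / 2) ^ 2 * x⁻¹) * f (Set.projIci 1 x)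
  rw [setLIntegral_density_eq_setLIntegral_sinh_sq fun x => f (Set.projIci 1 x), ← h_sinh] at h_dens
  rw [lintegral_map hf continuous_expHalf.measurable,
    lintegral_withDensity_eq_lintegral_mul _ measurable_ofReal_density hf]
  refine (lintegral_withDensity_eq_lintegral_mul _ measurable_ofReal_sinh_sq
    (hf.comp continuous_expHalf.measurable)).trans ?_
  refine Eq.trans (lintegral_congr fun r => ?_)
    (h_dens.symm.trans (lintegral_congr fun x => congrArg _ (hf_ext x)))
  exact congrArg (ENNReal.ofReal (Real.sinh r ^ 2) * ·) (hf_ext (expHalf r)).symm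

lemma map_expHalf_cartanMeasure (μ μ' : Measure SU2) [SFinite μ] [SFinite μ'] :
    (cartanMeasure μ μ').map (Prod.map id (Prod.map expHalf id)) = cartanMeasureX μ μ' := by
  have h_exp := continuous_expHalf.measurable
  rw [cartanMeasure, cartanMeasureX, prod_prod_withDensity_middle _ _ _ measurable_ofReal_sinh_sq,
    prod_prod_withDensity_middle _ _ _ measurable_ofReal_density,
    ← Measure.map_prod_map _ _ measurable_id (h_exp.prodMap measurable_id),
    ← Measure.map_prod_map _ _ h_exp measurable_id, map_expHalf_withDensity, Measure.map_id,
    Measure.map_id]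

lemma map_kakx_cartanMeasureX (μ μ' : Measure SU2) [SFinite μ] [SFinite μ'] :
    (cartanMeasureX μ μ').map kakx = (cartanMeasure μ μ').map kak := by
  rw [← map_expHalf_cartanMeasure, Measure.map_map continuous_kakx.measurable
    (measurable_id.prodMap (continuous_expHalf.measurable.prodMap measurable_id))]
  exact congrArg (Measure.map · _) (funext kakx_expHalf)

end ExponentialCoordinate

section Integration

variable {X Y : Type*} [MeasurableSpace X] [MeasurableSpace Y] {m : Measure X} {d : X → ℝ}
  {T : X → Y} {c : ℝ} {f : Y → ℝ}

lemma integrable_smul_map_withDensity_iff (hd : Measurable d) (hd_nonneg : ∀ x, 0 ≤ d x)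
    (hT : Measurable T) (hc : 0 < c) (hf : Measurable f) :
    Integrable f (ENNReal.ofReal c • (m.withDensity fun x => ENNReal.ofReal (d x)).map T) ↔
      Integrable (fun x => d x * f (T x)) m := by
  rw [integrable_smul_measure (ENNReal.ofReal_pos.2 hc).ne' ENNReal.ofReal_ne_top,
    integrable_map_measure hf.aestronglyMeasurable hT.aemeasurable,
    integrable_withDensity_iff_integrable_smul' hd.ennreal_ofReal
      (ae_of_all _ fun _ => ENNReal.ofReal_lt_top)]
  simp only [ENNReal.toReal_ofReal (hd_nonneg _), smul_eq_mul, Function.comp_apply]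

lemma integral_smul_map_withDensity (hd : Measurable d) (hd_nonneg : ∀ x, 0 ≤ d x)
    (hT : Measurable T) (hc : 0 ≤ c) (hf : Measurable f) :
    ∫ y, f y ∂(ENNReal.ofReal c • (m.withDensity fun x => ENNReal.ofReal (d x)).map T) =
      c * ∫ x, d x * f (T x) ∂m := by
  rw [integral_smul_measure, integral_map hT.aemeasurable hf.aestronglyMeasurable,
    integral_withDensity_eq_integral_toReal_smul hd.ennreal_ofReal
      (ae_of_all _ fun _ => ENNReal.ofReal_lt_top), ENNReal.toReal_ofReal hc]
  simp only [ENNReal.toReal_ofReal (hd_nonneg _), smul_eq_mul]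

end Integration

section HaarIntegration

lemma exists_pos_eq_ofReal_smul {G : Type*} [Group G] [TopologicalSpace G] [IsTopologicalGroup G]
    [LocallyCompactSpace G] [SecondCountableTopology G] [MeasurableSpace G] [BorelSpace G]
    (ν ν' : Measure G) [ν.IsHaarMeasure] [ν'.IsHaarMeasure] :
    ∃ c : ℝ, 0 < c ∧ ν' = ENNReal.ofReal c • ν := by
  refine ⟨ν'.haarScalarFactor ν, Measure.haarScalarFactor_pos_of_isHaarMeasure ν' ν, ?_⟩
  rw [ENNReal.ofReal_coe_nnreal]
  exact Measure.isMulLeftInvariant_eq_smul ν' ν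

variable (μ μ' : Measure SU2) {c : ℝ} {f : SL2C → ℝ}

lemma integral_smul_map_kak (hc : 0 < c) (hf : Measurable f) :
    (Integrable f (ENNReal.ofReal c • (cartanMeasure μ μ').map kak) ↔
      Integrable (fun p : SU2 × Set.Ici (0 : ℝ) × SU2 => Real.sinh (p.2.1 : ℝ) ^ 2 * f (kak p))
        (μ.prod ((lebesgueIci 0).prod μ'))) ∧
    ∫ g, f g ∂(ENNReal.ofReal c • (cartanMeasure μ μ').map kak) =
      c * ∫ p : SU2 × Set.Ici (0 : ℝ) × SU2, Real.sinh (p.2.1 : ℝ) ^ 2 * f (kak p)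
        ∂(μ.prod ((lebesgueIci 0).prod μ')) := by
  have h_meas : Measurable fun p : SU2 × Set.Ici (0 : ℝ) × SU2 => Real.sinh (p.2.1 : ℝ) ^ 2 := by
    fun_prop
  have h_nonneg (p : SU2 × Set.Ici (0 : ℝ) × SU2) : 0 ≤ Real.sinh (p.2.1 : ℝ) ^ 2 := sq_nonneg _
  have h_kak := continuous_kak.measurable
  exact ⟨integrable_smul_map_withDensity_iff h_meas h_nonneg h_kak hc hf,
    integral_smul_map_withDensity h_meas h_nonneg h_kak hc.le hf⟩

lemma integral_smul_map_kakx (hc : 0 < c) (hf : Measurable f) :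
    (Integrable f (ENNReal.ofReal c • (cartanMeasureX μ μ').map kakx) ↔
      Integrable (fun p : SU2 × Set.Ici (1 : ℝ) × SU2 =>
        2 * (((p.2.1 : ℝ) ^ 2 - ((p.2.1 : ℝ) ^ 2)⁻¹) / 2) ^ 2 * (p.2.1 : ℝ)⁻¹ * f (kakx p))
        (μ.prod ((lebesgueIci 1).prod μ'))) ∧
    ∫ g, f g ∂(ENNReal.ofReal c • (cartanMeasureX μ μ').map kakx) =
      c * ∫ p : SU2 × Set.Ici (1 : ℝ) × SU2,
        2 * (((p.2.1 : ℝ) ^ 2 - ((p.2.1 : ℝ) ^ 2)⁻¹) / 2) ^ 2 * (p.2.1 : ℝ)⁻¹ * f (kakx p)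
        ∂(μ.prod ((lebesgueIci 1).prod μ')) := by
  have h_meas : Measurable fun p : SU2 × Set.Ici (1 : ℝ) × SU2 =>
      2 * (((p.2.1 : ℝ) ^ 2 - ((p.2.1 : ℝ) ^ 2)⁻¹) / 2) ^ 2 * (p.2.1 : ℝ)⁻¹ := by
    fun_prop
  have h_nonneg (p : SU2 × Set.Ici (1 : ℝ) × SU2) :
      0 ≤ 2 * (((p.2.1 : ℝ) ^ 2 - ((p.2.1 : ℝ) ^ 2)⁻¹) / 2) ^ 2 * (p.2.1 : ℝ)⁻¹ :=
    mul_nonneg (by positivity) (inv_nonneg.2 (zero_le_one.trans p.2.1.2))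
  have h_kakx := continuous_kakx.measurable
  exact ⟨integrable_smul_map_withDensity_iff h_meas h_nonneg h_kakx hc hf,
    integral_smul_map_withDensity h_meas h_nonneg h_kakx hc.le hf⟩

end HaarIntegration

section Differential

lemma inv_cartanA_val (r : ℝ) : ((cartanA r)⁻¹ : SL2C).1 =
    !![((Real.exp (-(r / 2)) : ℝ) : ℂ), 0; 0, ((Real.exp (r / 2) : ℝ) : ℂ)] := by
  rw [Matrix.SpecialLinearGroup.coe_inv]
  simp only [cartanA, adjugate_fin_two_of, neg_zero]

lemma inv_cartanA_mul_mul_cartanA (r : ℝ) (X : M2) :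
    ((cartanA r)⁻¹ : SL2C).1 * X * (cartanA r).1 =
      !![X 0 0, ((Real.exp (-r) : ℝ) : ℂ) * X 0 1; ((Real.exp r : ℝ) : ℂ) * X 1 0, X 1 1] := by
  have h_diag : (Real.exp (-(r / 2)) : ℂ) * Real.exp (r / 2) = 1 := by
    rw [← Complex.ofReal_mul, ← Real.exp_add, neg_add_cancel, Real.exp_zero, Complex.ofReal_one]
  have h_pos : Real.exp r = Real.exp (r / 2) * Real.exp (r / 2) := by
    rw [← Real.exp_add, add_halves]
  have h_neg : Real.exp (-r) = Real.exp (-(r / 2)) * Real.exp (-(r / 2)) := by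
    rw [← Real.exp_add, ← neg_add, add_halves]
  rw [inv_cartanA_val, h_pos, h_neg, Complex.ofReal_mul, Complex.ofReal_mul]
  nth_rewrite 1 [Matrix.eta_fin_two X]
  simp only [cartanA, mul_fin_two, zero_mul, mul_zero, add_zero, zero_add]
  congr! 4
  · linear_combination X 0 0 * h_diag
  · ring
  · ring
  · rw [mul_right_comm, mul_comm ((Real.exp (r / 2) : ℝ) : ℂ), h_diag, one_mul]

lemma trace_inv_mul_mul {n R : Type*} [Fintype n] [DecidableEq n] [CommRing R]
    (g : Matrix.SpecialLinearGroup n R) (X : Matrix n n R) :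
    (g⁻¹.1 * X * g.1).trace = X.trace := by
  rw [trace_mul_cycle, ← Matrix.SpecialLinearGroup.coe_mul, mul_inv_cancel,
    Matrix.SpecialLinearGroup.coe_one, one_mul]

instance : FiniteDimensional ℝ (su2 × diagA × su2) := Module.Finite.of_basis domBasis

/-- The differential of `phi r` at `0`, namely `(X, Y, X') ↦ A_r⁻¹ X A_r + Y + X'`. -/
noncomputable def dphi (r : ℝ) : (su2 × diagA × su2) →L[ℝ] sl2 :=
  LinearMap.toContinuousLinearMap
    { toFun := fun p => ⟨((cartanA r)⁻¹ : SL2C).1 * p.1.1 * (cartanA r).1 + p.2.1.1 + p.2.2.1,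
        add_mem (add_mem ((trace_inv_mul_mul (cartanA r) p.1.1).trans p.1.2.2) p.2.1.2.2)
          p.2.2.2.2⟩
      map_add' := fun p q => by
        apply Subtype.ext
        simp only [Prod.fst_add, Prod.snd_add, Submodule.coe_add, mul_add, add_mul]
        abel
      map_smul' := fun c p => by
        apply Subtype.ext
        simp [smul_add] }

lemma dphi_apply_val (r : ℝ) (p : su2 × diagA × su2) : (dphi r p).1 =
    ((cartanA r)⁻¹ : SL2C).1 * p.1.1 * (cartanA r).1 + p.2.1.1 + p.2.2.1 :=
  rfl

lemma hasFDerivAt_exp_comp_zero {E 𝔸 : Type*} [NormedAddCommGroup E] [NormedSpace ℝ E]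
    [NormedRing 𝔸] [NormedAlgebra ℝ 𝔸] [CompleteSpace 𝔸] (L : E →L[ℝ] 𝔸) :
    HasFDerivAt (fun x => NormedSpace.exp (L x)) L 0 := by
  have h_exp : HasFDerivAt NormedSpace.exp (1 : 𝔸 →L[ℝ] 𝔸) (L 0) := by
    rw [map_zero]
    exact hasFDerivAt_exp_zero
  exact h_exp.comp 0 L.hasFDerivAt

lemma hasFDerivAt_phi (r : ℝ) : HasFDerivAt (phi r) (sl2.subtypeL ∘L dphi r) 0 := by
  let _ : NormedRing M2 := Matrix.linftyOpNormedRing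
  let _ : NormedAlgebra ℝ M2 := Matrix.linftyOpNormedAlgebra
  have h_left := hasFDerivAt_exp_comp_zero
    (su2.subtypeL ∘L ContinuousLinearMap.fst ℝ su2 (diagA × su2))
  have h_middle := hasFDerivAt_exp_comp_zero (diagA.subtypeL ∘L
    ContinuousLinearMap.fst ℝ diagA su2 ∘L ContinuousLinearMap.snd ℝ su2 (diagA × su2))
  have h_right := hasFDerivAt_exp_comp_zero (su2.subtypeL ∘L
    ContinuousLinearMap.snd ℝ diagA su2 ∘L ContinuousLinearMap.snd ℝ su2 (diagA × su2))
  have h_prod := (((h_left.const_mul ((cartanA r)⁻¹ : SL2C).1).mul_const' (cartanA r).1).mul'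
    h_middle).mul' h_right
  have h_inv : ((cartanA r)⁻¹ : SL2C).1 * (cartanA r).1 = 1 := by
    rw [← Matrix.SpecialLinearGroup.coe_mul, inv_mul_cancel, Matrix.SpecialLinearGroup.coe_one]
  refine h_prod.congr_fderiv (ContinuousLinearMap.ext fun p => ?_)
  change ((cartanA r)⁻¹ : SL2C).1 * NormedSpace.exp (0 : M2) * (cartanA r).1 *
      NormedSpace.exp (0 : M2) * p.2.2.1 + (((cartanA r)⁻¹ : SL2C).1 * NormedSpace.exp (0 : M2) *
      (cartanA r).1 * p.2.1.1 + ((cartanA r)⁻¹ : SL2C).1 * p.1.1 * (cartanA r).1 *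
      NormedSpace.exp (0 : M2)) * NormedSpace.exp (0 : M2) = (dphi r p).1
  simp only [NormedSpace.exp_zero, mul_one, h_inv, one_mul, dphi_apply_val]
  abel

/-- The matrix of the differential of `phi r` at `0` in the bases `domBasis` and `codBasis`, where
`c` and `s` stand for `cosh r` and `sinh r`. -/
def dphiMatrix (c s : ℝ) : Matrix (Fin 6) (Fin 7) ℝ :=
  !![ c, 1, 0, 0, 0, 0, 0;
     -s, 0, 0, 0, 0, 0, 0;
      0, 0, c, 1, 0, 0, 0;
      0, 0, s, 0, 0, 0, 0;
      0, 0, 0, 0, 1, 1, 0;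
      0, 0, 0, 0, 0, 0, 1]

lemma inv_cartanA_mul_I_smul_σx_mul_cartanA (r : ℝ) :
    ((cartanA r)⁻¹ : SL2C).1 * (Complex.I • σx) * (cartanA r).1 =
      Real.cosh r • Complex.I • σx + Real.sinh r • σy := by
  rw [inv_cartanA_mul_mul_cartanA, ← Real.cosh_sub_sinh r, ← Real.cosh_add_sinh r]
  ext i j
  fin_cases i <;> fin_cases j <;>
    simp [σx, σy, mul_comm Complex.I, sub_eq_add_neg, add_mul, -Complex.ofReal_cosh,
      -Complex.ofReal_sinh, -Real.cosh_sub_sinh, -Real.cosh_add_sinh]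

lemma inv_cartanA_mul_I_smul_σy_mul_cartanA (r : ℝ) :
    ((cartanA r)⁻¹ : SL2C).1 * (Complex.I • σy) * (cartanA r).1 =
      Real.cosh r • Complex.I • σy - Real.sinh r • σx := by
  rw [inv_cartanA_mul_mul_cartanA, ← Real.cosh_sub_sinh r, ← Real.cosh_add_sinh r]
  ext i j
  fin_cases i <;> fin_cases j <;>
    simp [σx, σy, sub_eq_add_neg, add_comm, -Complex.ofReal_cosh, -Complex.ofReal_sinh,
      -Real.cosh_sub_sinh, -Real.cosh_add_sinh]

lemma inv_cartanA_mul_I_smul_σz_mul_cartanA (r : ℝ) :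
    ((cartanA r)⁻¹ : SL2C).1 * (Complex.I • σz) * (cartanA r).1 = Complex.I • σz := by
  rw [inv_cartanA_mul_mul_cartanA]
  ext i j
  fin_cases i <;> fin_cases j <;> simp [σz]

lemma toMatrix_dphi (r : ℝ) : LinearMap.toMatrix domBasis codBasis (dphi r : _ →ₗ[ℝ] sl2) =
    dphiMatrix (Real.cosh r) (Real.sinh r) := by
  rw [← LinearEquiv.eq_symm_apply, LinearMap.toMatrix_symm]
  refine domBasis.ext fun j => Subtype.ext ?_
  rw [Matrix.toLin_self, ContinuousLinearMap.coe_coe, dphi_apply_val]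
  fin_cases j <;>
    simp [dphiMatrix, domBasis, codBasis, domVec, codVec, kx, ky, kz, az, Fin.sum_univ_succ,
      inv_cartanA_mul_I_smul_σx_mul_cartanA, inv_cartanA_mul_I_smul_σy_mul_cartanA,
      inv_cartanA_mul_I_smul_σz_mul_cartanA, sub_eq_add_neg,
      -Matrix.SpecialLinearGroup.coe_inv, -Algebra.mul_smul_comm, -Matrix.mul_smul]

end Differential

section Minors

lemma maxMinor_eq_zero_of_column_eq {J : Matrix (Fin 6) (Fin 7) ℝ} {a b j : Fin 7} (hab : a ≠ b)
    (haj : a ≠ j) (hbj : b ≠ j) (h_col : ∀ i, J i a = J i b) : maxMinor J j = 0 := by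
  obtain ⟨a', rfl⟩ := Fin.exists_succAbove_eq haj
  obtain ⟨b', rfl⟩ := Fin.exists_succAbove_eq hbj
  exact det_zero_of_column_eq (fun h => hab (congrArg _ h)) h_col

lemma maxMinor_dphiMatrix_of_eq_four_or_five (c s : ℝ) {j : Fin 7} (hj : j = 4 ∨ j = 5) :
    maxMinor (dphiMatrix c s) j = -s ^ 2 := by
  have h_submatrix : (dphiMatrix c s).submatrix id j.succAbove =
      !![ c, 1, 0, 0, 0, 0;
         -s, 0, 0, 0, 0, 0;
          0, 0, c, 1, 0, 0;
          0, 0, s, 0, 0, 0;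
          0, 0, 0, 0, 1, 0;
          0, 0, 0, 0, 0, 1] := by
    ext i k
    rcases hj with rfl | rfl <;> fin_cases i <;> fin_cases k <;> rfl
  rw [maxMinor, h_submatrix]
  simp [det_succ_row_zero, Fin.sum_univ_succ, Fin.succAbove, sq]

lemma abs_maxMinor_dphiMatrix (c s : ℝ) (j : Fin 7) :
    |maxMinor (dphiMatrix c s) j| = if j = 4 ∨ j = 5 then s ^ 2 else 0 := by
  split_ifs with hj
  · rw [maxMinor_dphiMatrix_of_eq_four_or_five c s hj, abs_neg, abs_sq]
  · obtain ⟨h_four, h_five⟩ := not_or.1 hj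
    rw [maxMinor_eq_zero_of_column_eq (a := 4) (b := 5) (by decide) (Ne.symm h_four)
      (Ne.symm h_five), abs_zero]
    intro i
    fin_cases i <;> rfl

end Minors

end CartanSL2

theorem mainTheorem2 :
    -- `SL(2, ℂ) = SU(2) · A⁺ · SU(2)`
    Function.Surjective kak ∧
    -- `A_x = A_r` for `x = e^{r/2}`, and this substitution is a bijection `[0, ∞) → [1, ∞)`
    (Function.Bijective expHalf ∧ ∀ r : Set.Ici (0 : ℝ), cartanAx (expHalf r) = cartanA r) ∧
    -- the Haar measure of `SL(2, ℂ)` in the coordinates `(k, r, k')` and `(k, x, k')`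
    (∀ μ μ' : Measure SU2, μ.IsHaarMeasure → μ'.IsHaarMeasure →
      ((cartanMeasure μ μ').map kak).IsHaarMeasure ∧
      ((cartanMeasure μ μ').map kak).IsMulRightInvariant ∧
      (cartanMeasureX μ μ').map kakx = (cartanMeasure μ μ').map kak ∧
      (cartanMeasure μ μ').map (Prod.map id (Prod.map expHalf id)) = cartanMeasureX μ μ' ∧
      ∀ μG : Measure SL2C, μG.IsHaarMeasure →
        ∃ c : ℝ, 0 < c ∧
          μG = ENNReal.ofReal c • (cartanMeasure μ μ').map kak ∧
          ∀ f : SL2C → ℝ, Measurable f →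
            (Integrable f μG ↔
              Integrable (fun p : SU2 × Set.Ici (0 : ℝ) × SU2 =>
                Real.sinh (p.2.1 : ℝ) ^ 2 * f (toSL p.1 * cartanA p.2.1 * toSL p.2.2))
                (μ.prod ((lebesgueIci 0).prod μ'))) ∧
            (∫ g, f g ∂μG =
              c * ∫ p : SU2 × Set.Ici (0 : ℝ) × SU2,
                Real.sinh (p.2.1 : ℝ) ^ 2 * f (toSL p.1 * cartanA p.2.1 * toSL p.2.2)
                ∂(μ.prod ((lebesgueIci 0).prod μ'))) ∧
            (Integrable f μG ↔
              Integrable (fun p : SU2 × Set.Ici (1 : ℝ) × SU2 =>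
                2 * (((p.2.1 : ℝ) ^ 2 - ((p.2.1 : ℝ) ^ 2)⁻¹) / 2) ^ 2 * (p.2.1 : ℝ)⁻¹ *
                  f (toSL p.1 * cartanAx p.2.1 * toSL p.2.2))
                (μ.prod ((lebesgueIci 1).prod μ'))) ∧
            (∫ g, f g ∂μG =
              c * ∫ p : SU2 × Set.Ici (1 : ℝ) × SU2,
                2 * (((p.2.1 : ℝ) ^ 2 - ((p.2.1 : ℝ) ^ 2)⁻¹) / 2) ^ 2 * (p.2.1 : ℝ)⁻¹ *
                  f (toSL p.1 * cartanAx p.2.1 * toSL p.2.2)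
                ∂(μ.prod ((lebesgueIci 1).prod μ')))) ∧
    -- the differential at `0` of the parametrisation, its matrix and its maximal minors
    (∀ r : ℝ, ∃ D : (su2 × diagA × su2) →L[ℝ] sl2,
      HasFDerivAt (phi r) (sl2.subtypeL ∘L D) 0 ∧
      LinearMap.toMatrix domBasis codBasis (D : (su2 × diagA × su2) →ₗ[ℝ] sl2) =
        !![ Real.cosh r, 1, 0, 0, 0, 0, 0;
           -Real.sinh r, 0, 0, 0, 0, 0, 0;
            0, 0, Real.cosh r, 1, 0, 0, 0;
            0, 0, Real.sinh r, 0, 0, 0, 0;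
            0, 0, 0, 0, 1, 1, 0;
            0, 0, 0, 0, 0, 0, 1] ∧
      ∀ j : Fin 7,
        |maxMinor (LinearMap.toMatrix domBasis codBasis
            (D : (su2 × diagA × su2) →ₗ[ℝ] sl2)) j| =
          if j = 4 ∨ j = 5 then Real.sinh r ^ 2 else 0) := by
  refine ⟨surjective_kak, ⟨bijective_expHalf, cartanAx_expHalf⟩, fun μ μ' _ _ => ?_,
    fun r => ⟨dphi r, hasFDerivAt_phi r, toMatrix_dphi r, fun j => ?_⟩⟩
  · refine ⟨isHaarMeasure_map_kak μ μ', isMulRightInvariant_map_kak μ μ',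
      map_kakx_cartanMeasureX μ μ', map_expHalf_cartanMeasure μ μ', fun μG _ => ?_⟩
    obtain ⟨c, hc, rfl⟩ := exists_pos_eq_ofReal_smul ((cartanMeasure μ μ').map kak) μG
    refine ⟨c, hc, rfl, fun f hf => ?_⟩
    obtain ⟨h_integrable, h_integral⟩ := integral_smul_map_kak μ μ' hc hf
    obtain ⟨h_integrable_x, h_integral_x⟩ := integral_smul_map_kakx μ μ' hc hf
    rw [map_kakx_cartanMeasureX] at h_integrable_x h_integral_x
    exact ⟨h_integrable, h_integral, h_integrable_x, h_integral_x⟩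
  · rw [toMatrix_dphi]
    exact abs_maxMinor_dphiMatrix _ _ j
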